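/- For a positive integer $r$ and an integer $n$ let $\overline{n}$ denote the smallest non-negative residue of $n$ modulo $r$. An isolated cyclic quotient singularity $(0\in W)$ of dimension $3$ is the image of the origin in $W=\mathbb{A}^3_{\mathbb{C}}/\mu_r$, where $\xi\in\mu_r$ acts by $x_i\mapsto \xi^{a_i}x_i$ and $a_1,a_2,a_3$ are coprime to $r$; its minimal log discrepancy $\mathrm{mld}_0(W)$ is the infimum of the log discrepancies $a(E;W)$ over all prime divisors $E$ over $W$ with center $0$. Call a real number $\delta>0$ a gap constant if $\mathrm{mld}_0(W)\le 1-\delta$ for every isolated cyclic quotient singularity $(0\in W)$ of dimension $3$ with $\mathrm{mld}_0(W)<1$. Let $\delta_3>0$ be a real number. If $\delta_3$ is a gap constant, then $\delta_3<1$. Moreover, for every $\delta_3>0$ (in particular for every gap constant) there is a real number $\delta_0$ with $0<\delta_0\le\delta_3$ and $\delta_0<1$ such that the following holds. Let $r$ be a positive integer and let $a_1,a_2,a_3,a_4,e$ be integers such that $\gcd(e,r)=\gcd(a_4,r)$ and $a_1,a_2,a_3$ are coprime to $r$. Assume that there is an integer $k_0$ with $1\le k_0\le r-1$ such that $$\sum_{i=1}^4\overline{a_ik_0}=\overline{ek_0}+k_0,$$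 and that for every integer $k$ with $1\le k\le r-1$ and $k\ne k_0$, $$\sum_{i=1}^4\overline{a_ik}\ \ge\ \overline{ek}+r.$$ Then $\dfrac{k_0}{r}\le 1-\delta_0$. -/

import Mathlib

open scoped ExteriorAlgebra

noncomputable section

/-! ## Orders of rational functions and rational differential forms along a prime divisor -/

/-- Let `V` be a discrete valuation ring inside the field `K`, let `L` be a `V`-lattice of rank one
in the `K`-vector space `M` and let `x : M`. `HasOrderAlong V L x k` says that `x` has order `k`
with respect to `L`: for a uniformizer `ϖ` of `V`, the vector `ϖ ^ (-k) • x` generates `L`. -/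
def HasOrderAlong {K : Type*} [Field K] [Algebra ℂ K] (V : Subalgebra ℂ K)
    {M : Type*} [AddCommGroup M] [Module K M] (L : Submodule V M) (x : M) (k : ℤ) : Prop :=
  ∃ ϖ : V, Irreducible ϖ ∧ Submodule.span V {((ϖ : K) ^ (-k)) • x} = L

/-- The rational function `g : K` has order `k` along `V`. -/
def HasFunctionOrder {K : Type*} [Field K] [Algebra ℂ K] (V : Subalgebra ℂ K)
    (g : K) (k : ℤ) : Prop :=
  HasOrderAlong V (Submodule.span V {(1 : K)}) g k

/-- The `V`-submodule of the rational `n`-forms of `K` generated by the forms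
`dv₁ ∧ ⋯ ∧ dvₙ` with all `vᵢ` in `V`; if `V` is the local ring of a prime divisor of a normal
`n`-dimensional variety with function field `K`, these are the `n`-forms that are regular at the
generic point of the divisor. -/
def regularForms {K : Type*} [Field K] [Algebra ℂ K] (V : Subalgebra ℂ K) (n : ℕ) :
    Submodule V (⋀[K]^n (Ω[K⁄ℂ])) :=
  Submodule.span V (Set.range fun v : Fin n → V =>
    exteriorPower.ιMulti K n fun i => KaehlerDifferential.D ℂ K (v i : K))

/-- The rational `n`-form `ω` has order `k` along `V`. -/
def HasFormOrder {K : Type*} [Field K] [Algebra ℂ K] (V : Subalgebra ℂ K) {n : ℕ}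
    (ω : ⋀[K]^n (Ω[K⁄ℂ])) (k : ℤ) : Prop :=
  HasOrderAlong V (regularForms V n) ω k

/-! ## Prime divisors over an affine variety, log discrepancies, minimal log discrepancies

`A` is the coordinate ring of a normal affine variety `X` over `ℂ` of dimension `n`, with
function field `FractionRing A`. -/

/-- The local ring `𝒪_{X,P}` at a prime `P` of `A`, as a subring of the function field. -/
def localRingAt (A : Type*) [CommRing A] [IsDomain A] [Algebra ℂ A] (P : Ideal A) [P.IsPrime] :
    Subalgebra ℂ (FractionRing A) :=
  (Localization.subalgebra.ofField (FractionRing A) P.primeCompl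
    P.primeCompl_le_nonZeroDivisors).restrictScalars ℂ

/-- `V` is (the local ring of) a prime divisor over `X = Spec A`, i.e. `V = 𝒪_{Y,E}` for a prime
divisor `E` of a normal variety `Y` with a birational morphism `Y → X`: a discrete
valuation ring with fraction field that of `A`, essentially of finite type over `ℂ`,
containing `A`. -/
structure IsDivisorOver (A : Type*) [CommRing A] [IsDomain A] [Algebra ℂ A]
    (V : Subalgebra ℂ (FractionRing A)) : Prop where
  isDiscreteValuationRing : IsDiscreteValuationRing V
  isFractionRing : IsFractionRing V (FractionRing A)
  essFiniteType : Algebra.EssFiniteType ℂ V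
  algebraMap_mem : ∀ f : A, algebraMap A (FractionRing A) f ∈ V

/-- The center on `Spec A` of the divisor `V` is the point `p`: the elements of `p` are exactly
those elements of `A` that are not units in `V`. -/
def HasCenter {A : Type*} [CommRing A] [IsDomain A] [Algebra ℂ A]
    (V : Subalgebra ℂ (FractionRing A)) (p : Ideal A) : Prop :=
  ∀ f : A, f ∈ p ↔ ¬ ∃ u : Vˣ, ((u : V) : FractionRing A) = algebraMap A (FractionRing A) f

/-- The log discrepancy `a(E; X)` of the divisor `V = 𝒪_{Y,E}` over `X = Spec A` is `a`.
Here `ω` is a nonzero rational `n`-form, so that `K_X = div_X(ω)` and `K_Y = div_Y(ω)`; the second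
line says `m K_X = div_X(g)` (orders at all prime divisors of `X`), so that
`f^* K_X = (1 / m) div_Y(g)`; and `a = 1 + mult_E (K_Y - f^* K_X)`. -/
def HasLogDiscrepancy (A : Type*) [CommRing A] [IsDomain A] [Algebra ℂ A] (n : ℕ)
    (V : Subalgebra ℂ (FractionRing A)) (a : ℝ) : Prop :=
  ∃ (ω : ⋀[FractionRing A]^n (Ω[FractionRing A⁄ℂ])) (m : ℕ) (g : FractionRing A),
    ω ≠ 0 ∧ 0 < m ∧ g ≠ 0 ∧
    (∀ (P : Ideal A) [P.IsPrime], P.height = 1 →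
      ∃ k : ℤ, HasFormOrder (localRingAt A P) ω k ∧
        HasFunctionOrder (localRingAt A P) g (m * k)) ∧
    ∃ i j : ℤ, HasFormOrder V ω i ∧ HasFunctionOrder V g j ∧ a = 1 + (i - j / m : ℝ)

/-- The minimal log discrepancy `mld_p(X)` of the `n`-dimensional variety `X = Spec A` over the
closed point `p`: the infimum of the log discrepancies of all prime divisors over `X` with
center `p`. -/
def mldAt (A : Type*) [CommRing A] [IsDomain A] [Algebra ℂ A] (n : ℕ) (p : Ideal A) : EReal :=
  sInf {x : EReal | ∃ (V : Subalgebra ℂ (FractionRing A)) (a : ℝ),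
    IsDivisorOver A V ∧ HasCenter V p ∧ HasLogDiscrepancy A n V a ∧ x = (a : EReal)}

/-! ## Cyclic quotient singularities -/

/-- The action of `ξ ∈ μ_r` on polynomials by `xᵢ ↦ ξ ^ aᵢ xᵢ`. -/
def cyclicAction {n : ℕ} (r : ℕ) (a : Fin n → ℤ) (ξ : rootsOfUnity r ℂ) :
    MvPolynomial (Fin n) ℂ →ₐ[ℂ] MvPolynomial (Fin n) ℂ :=
  MvPolynomial.aeval fun i =>
    MvPolynomial.C (((ξ : ℂˣ) ^ a i : ℂˣ) : ℂ) * MvPolynomial.X i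

/-- The coordinate ring of the cyclic quotient singularity `𝔸ⁿ / μ_r` of type
`(1/r)(a₁, …, aₙ)`: the ring of invariant polynomials. -/
abbrev cyclicQuotientRing {n : ℕ} (r : ℕ) (a : Fin n → ℤ) :
    Subalgebra ℂ (MvPolynomial (Fin n) ℂ) :=
  ⨅ ξ : rootsOfUnity r ℂ, AlgHom.equalizer (cyclicAction r a ξ) (AlgHom.id ℂ _)

/-- The image of the origin in `𝔸ⁿ / μ_r`: the invariants without constant term. -/
def originIdeal {n : ℕ} (r : ℕ) (a : Fin n → ℤ) : Ideal (cyclicQuotientRing r a) :=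
  RingHom.ker (MvPolynomial.constantCoeff.comp (cyclicQuotientRing r a).val.toRingHom)

/-- `mld_0(W)` for the cyclic quotient singularity `0 ∈ W` of type `(1/r)(a₁, …, aₙ)`. -/
def cyclicMld {n : ℕ} (r : ℕ) (a : Fin n → ℤ) : EReal :=
  mldAt (cyclicQuotientRing r a) n (originIdeal r a)

/-- `δ` is a gap constant below `1` for isolated cyclic quotient singularities of dimension `3`:
every such `0 ∈ W` with `mld_0(W) < 1` satisfies `mld_0(W) ≤ 1 - δ`. These
singularities are those of type `(1/r)(a₁, a₂, a₃)` with all `aᵢ` coprime to `r`. -/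
def IsMldGapThree (δ : ℝ) : Prop :=
  0 < δ ∧ ∀ (r : ℕ) (a : Fin 3 → ℤ), 0 < r → (∀ i, Int.gcd (a i) r = 1) →
    cyclicMld r a < 1 → cyclicMld r a ≤ ((1 - δ : ℝ) : EReal)

/-- `(n̄)_r`, the smallest non-negative residue of the integer `n` modulo `r` (for `0 < r`). -/
def residue (r : ℕ) (n : ℤ) : ℤ := n % (r : ℤ)

end

/-! The two assertions are independent.

Bound on `k₀ / r`. Put D(k) = ∑ residue(aᵢk) - residue(ek) - k, so D(k₀) = 0 and D((m+1)k₀ mod r) is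
divisible by r for every m. By Dirichlet's theorem and compactness of the cube there is an absolute
M such that every six real numbers x have a multiplier m ≤ M, m ≥ 1, with the fractional parts of
(m+1)x within 1/6 of those of x (`exists_bounded_return_time`). Apply this to the aᵢk₀/r, ek₀/r and
k₀/r. If k₀/r > 1 - 1/(M+1), then k = (m+1)k₀ mod r is neither 0 nor k₀, because small multiples of
r - k₀ stay below r. The six residues move by less than r/6 each, so |D(k)| < r and hence D(k) = 0.
This contradicts D(k) ≥ r - k > 0. Thus c = 1/(M+1) works (`exists_exceptional_bound`).

Gap constants. The singularity (1/4)(1,1,1) has mld 3/4, so a gap constant is at most 1/4. With f_c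
= x_c⁴, let η be the wedge of the forms df_c/f_c. In codimension one, four times the divisor of η is
the divisor of 1/(f₀f₁f₂), as the charts with coordinates x_c⁴ and x_i/x_c show. Along a divisor
centred at the origin η has at most a simple pole and every f_c vanishes, so the log discrepancy is
at least 1 - 1 + 3/4 (`three_quarters_le_of_hasLogDiscrepancy`). The exceptional divisor of the
blowup attains this value (`cyclicMld_le_three_quarters`). -/

/-! ### Simultaneous approximation and uniform return times -/

/-- Pigeonhole on the boxes of side 1/K in the torus: two multiples of `p` share a box, and `m` is
the difference of the two multipliers. -/
theorem exists_dirichlet {n : ℕ} (p : Fin n → ℝ) {ε : ℝ} (hε : 0 < ε) :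
    ∃ m : ℕ, 1 ≤ m ∧ ∀ i, ∃ z : ℤ, |m * p i - z| < ε := by
  obtain ⟨K, hK⟩ := exists_nat_gt (1 / ε)
  have hK0 : (0 : ℝ) < K := lt_trans (by positivity) hK
  have hKε : 1 / (K : ℝ) < ε := by
    rw [div_lt_iff₀ hK0]; rw [div_lt_iff₀ hε] at hK; linarith
  have hb : ∀ (j : ℕ) (i : Fin n), ⌊(K : ℝ) * Int.fract (j * p i)⌋₊ < K := by
    intro j i
    rw [Nat.floor_lt (by positivity)]
    nlinarith [Int.fract_lt_one ((j : ℝ) * p i)]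
  obtain ⟨a, b, hab, hf⟩ := Finite.exists_ne_map_eq_of_infinite
    (fun (j : ℕ) (i : Fin n) => (⟨_, hb j i⟩ : Fin K))
  wlog hlt : a < b generalizing a b
  · exact this b a hab.symm hf.symm (by omega)
  refine ⟨b - a, by omega, fun i => ⟨⌊(b : ℝ) * p i⌋ - ⌊(a : ℝ) * p i⌋, ?_⟩⟩
  have h1 := congrArg Fin.val (congrFun hf i)
  simp only at h1
  have ha := Nat.floor_le (a := (K : ℝ) * Int.fract (a * p i)) (by positivity)
  have ha' := Nat.lt_floor_add_one ((K : ℝ) * Int.fract (a * p i))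
  have hb := Nat.floor_le (a := (K : ℝ) * Int.fract (b * p i)) (by positivity)
  have hb' := Nat.lt_floor_add_one ((K : ℝ) * Int.fract (b * p i))
  rw [h1] at ha ha'
  have h2 : |Int.fract ((b : ℝ) * p i) - Int.fract ((a : ℝ) * p i)| < 1 / K := by
    rw [lt_div_iff₀ hK0]
    have h := abs_mul (Int.fract ((b : ℝ) * p i) - Int.fract ((a : ℝ) * p i)) K
    rw [abs_of_pos hK0] at h
    rw [← h, abs_lt]
    constructor <;> nlinarith
  have h3 : ((b - a : ℕ) : ℝ) * p i - ((⌊(b : ℝ) * p i⌋ - ⌊(a : ℝ) * p i⌋ : ℤ) : ℝ) =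
      Int.fract ((b : ℝ) * p i) - Int.fract ((a : ℝ) * p i) := by
    rw [Nat.cast_sub hlt.le, Int.fract, Int.fract]; push_cast; ring
  rw [h3]
  exact h2.trans hKε

/-- Around every point of the cube there is a common return time. -/
theorem eventually_fract_mul_near {n : ℕ} (p : Fin n → ℝ) (hp : ∀ i, p i ∈ Set.Icc (0 : ℝ) 1)
    {ε : ℝ} (hε : 0 < ε) :
    ∃ m : ℕ, 1 ≤ m ∧ ∀ᶠ x : Fin n → ℝ in nhds p, (∀ i, x i ∈ Set.Ico (0 : ℝ) 1) →
      ∀ i, |Int.fract (((m : ℝ) + 1) * x i) - x i| < ε := by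
  -- Three errors of size η occur: from Dirichlet, from (m+1)(x - p), and from x - p. Coordinates of
  -- `p` inside (0,1) are kept more than 3η away from the endpoints, so no wrap-around happens
  -- there.
  obtain ⟨η, hη, hηε, hηp⟩ : ∃ η : ℝ, 0 < η ∧ 3 * η < ε ∧ 3 * η < 1 ∧
      ∀ i, p i ≠ 0 → p i ≠ 1 → 3 * η < p i ∧ 3 * η < 1 - p i := by
    have h : ∀ᶠ η : ℝ in nhdsWithin 0 (Set.Ioi 0), 3 * η < ε ∧ 3 * η < 1 ∧
      ∀ i, p i ≠ 0 → p i ≠ 1 → 3 * η < p i ∧ 3 * η < 1 - p i := by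
      have key : ∀ c : ℝ, 0 < c → ∀ᶠ η : ℝ in nhdsWithin 0 (Set.Ioi 0), 3 * η < c := by
        intro c hc
        have : Filter.Tendsto (fun η : ℝ => 3 * η) (nhdsWithin 0 (Set.Ioi 0)) (nhds 0) := by
          have : Filter.Tendsto (fun η : ℝ => 3 * η) (nhds 0) (nhds (3 * 0)) :=
            tendsto_const_nhds.mul Filter.tendsto_id
          rw [mul_zero] at this
          exact this.mono_left nhdsWithin_le_nhds
        exact this.eventually_lt_const hc
      refine (key ε hε).and ((key 1 one_pos).and (Filter.eventually_all.2 fun i => ?_))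
      by_cases h0 : p i = 0
      · simp [h0]
      by_cases h1 : p i = 1
      · simp [h1]
      filter_upwards [key (p i) (lt_of_le_of_ne (hp i).1 (Ne.symm h0)),
        key (1 - p i) (sub_pos.2 (lt_of_le_of_ne (hp i).2 h1))] with η a b _ _
      exact ⟨a, b⟩
    obtain ⟨η, ⟨a, b⟩, c⟩ := (h.and self_mem_nhdsWithin).exists
    exact ⟨η, c, a, b⟩
  obtain ⟨m, hm, hmp⟩ := exists_dirichlet p hη
  refine ⟨m, hm, ?_⟩
  have hc : 0 < η / (m + 1) := by positivity
  have hx : ∀ᶠ x : Fin n → ℝ in nhds p, ∀ i, |x i - p i| < η / (m + 1) := by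
    refine Filter.eventually_all.2 fun i => ?_
    have := (continuous_apply i).tendsto p |>.eventually (Metric.ball_mem_nhds (p i) hc)
    simpa [Real.dist_eq] using this
  filter_upwards [hx] with x hx hx01 i
  have hxi := abs_lt.1 (hx i)
  have hm1 : (1 : ℝ) ≤ m := by exact_mod_cast hm
  have hd : η / (m + 1) * (m + 1) = η := by field_simp
  have hd1 : η / (m + 1) ≤ η := div_le_self hη.le (by linarith)
  have e1 : (m + 1) * (x i - p i) < η := by nlinarith
  have e2 : -η < (m + 1) * (x i - p i) := by nlinarith
  obtain ⟨z, hz⟩ := hmp i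
  have hz := abs_lt.1 hz
  have close : ∀ z : ℤ, 0 ≤ (m + 1) * x i - z → (m + 1) * x i - z < 1 →
      |((m + 1) * x i - z) - x i| < ε → |Int.fract (((m : ℝ) + 1) * x i) - x i| < ε := by
    intro z h0 h1 h
    have : Int.fract ((m + 1) * x i) = (m + 1) * x i - z := by
      rw [Int.fract_eq_iff]; exact ⟨h0, h1, z, by ring⟩
    rwa [this]
  -- At an endpoint an approximating integer might lie on the wrong side. There the integer part is
  -- named explicitly (0, or m when p i = 1), and x i ∈ [0,1) puts the remainder in range.
  by_cases h0 : p i = 0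
  · rw [h0] at e1 e2 hxi
    have := (hx01 i).1
    refine close 0 (by push_cast; nlinarith) (by push_cast; nlinarith) ?_
    rw [abs_lt]; push_cast
    constructor <;> nlinarith
  by_cases h1 : p i = 1
  · rw [h1] at e1 e2 hxi
    have := (hx01 i).2
    refine close m (by push_cast; nlinarith) (by push_cast; nlinarith) ?_
    rw [abs_lt]; push_cast
    constructor <;> nlinarith
  obtain ⟨q1, q2⟩ := hηp.2 i h0 h1
  refine close z (by nlinarith) (by nlinarith) ?_
  rw [abs_lt]
  constructor <;> nlinarith

/-- A bounded common return time for all points of the torus. -/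
theorem exists_bounded_return_time (n : ℕ) {ε : ℝ} (hε : 0 < ε) :
    ∃ M : ℕ, ∀ x : Fin n → ℝ, ∃ m : ℕ, 1 ≤ m ∧ m ≤ M ∧
      ∀ i, |Int.fract (((m : ℝ) + 1) * x i) - Int.fract (x i)| < ε := by
  have hcpt : IsCompact (Set.univ.pi fun _ : Fin n => Set.Icc (0 : ℝ) 1) :=
    isCompact_univ_pi fun _ => isCompact_Icc
  obtain ⟨M, hM⟩ : ∃ M : ℕ, ∀ x ∈ Set.univ.pi fun _ : Fin n => Set.Icc (0 : ℝ) 1,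
      (∀ i, x i ∈ Set.Ico (0 : ℝ) 1) → ∃ m : ℕ, 1 ≤ m ∧ m ≤ M ∧
      ∀ i, |Int.fract (((m : ℝ) + 1) * x i) - x i| < ε := by
    -- Having some bound M passes to subsets and finite unions, so local bounds give a global one.
    refine hcpt.induction_on (p := fun s => ∃ M : ℕ, ∀ x ∈ s,
      (∀ i, x i ∈ Set.Ico (0 : ℝ) 1) → ∃ m : ℕ, 1 ≤ m ∧ m ≤ M ∧
      ∀ i, |Int.fract (((m : ℝ) + 1) * x i) - x i| < ε) ⟨0, by simp⟩ ?_ ?_ ?_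
    · rintro s t hst ⟨M, hM⟩
      exact ⟨M, fun x hx => hM x (hst hx)⟩
    · rintro s t ⟨M, hM⟩ ⟨M', hM'⟩
      refine ⟨max M M', fun x hx h => ?_⟩
      rcases hx with hx | hx
      · obtain ⟨m, h1, h2, h3⟩ := hM x hx h
        exact ⟨m, h1, h2.trans (le_max_left _ _), h3⟩
      · obtain ⟨m, h1, h2, h3⟩ := hM' x hx h
        exact ⟨m, h1, h2.trans (le_max_right _ _), h3⟩
    · intro p hp
      obtain ⟨m, hm, h⟩ := eventually_fract_mul_near p (fun i => hp i trivial) hε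
      exact ⟨_, mem_nhdsWithin_of_mem_nhds h, m, fun x hx hx' => ⟨m, hm, le_rfl, hx hx'⟩⟩
  refine ⟨M, fun x => ?_⟩
  have hf : ∀ i, Int.fract (x i) ∈ Set.Ico (0 : ℝ) 1 := fun i =>
    ⟨Int.fract_nonneg _, Int.fract_lt_one _⟩
  obtain ⟨m, h1, h2, h3⟩ := hM (fun i => Int.fract (x i))
    (fun i _ => Set.Ico_subset_Icc_self (hf i)) hf
  refine ⟨m, h1, h2, fun i => ?_⟩
  have : Int.fract (((m : ℝ) + 1) * x i) = Int.fract ((m + 1) * Int.fract (x i)) := by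
    rw [Int.fract_eq_fract]
    refine ⟨(m + 1) * ⌊x i⌋, ?_⟩
    push_cast
    linear_combination ((m : ℝ) + 1) * (Int.floor_add_fract (x i)).symm
  rw [this]
  exact h3 i

/-! ### Residues and the exceptional index -/

theorem residue_div_eq_fract {r : ℕ} (hr : 0 < r) (n : ℤ) :
    (residue r n : ℝ) / r = Int.fract ((n : ℝ) / r) := by
  have hr' : (r : ℝ) ≠ 0 := by positivity
  symm
  rw [Int.fract_eq_iff]
  have h0 := Int.emod_nonneg n (b := (r : ℤ)) (by omega)
  have h1 := Int.emod_lt_of_pos n (b := (r : ℤ)) (by omega)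
  refine ⟨?_, ?_, n / r, ?_⟩
  · have : (0 : ℝ) ≤ residue r n := by exact_mod_cast h0
    positivity
  · rw [div_lt_one (by positivity)]
    exact_mod_cast h1
  · have := Int.emod_add_mul_ediv n r
    have h : (n : ℝ) = residue r n + r * ((n / r : ℤ) : ℝ) := by
      rw [residue]; exact_mod_cast this.symm
    rw [h]; field_simp; ring

/-- Universal bound away from `1` for the exceptional point. -/
theorem exists_exceptional_bound : ∃ c : ℝ, 0 < c ∧ ∀ (r : ℕ) (a : Fin 4 → ℤ) (e : ℤ) (k₀ : ℕ),
    0 < r → 1 ≤ k₀ → k₀ < r →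
    ∑ i, residue r (a i * k₀) = residue r (e * k₀) + k₀ →
    (∀ k : ℕ, 1 ≤ k → k < r → k ≠ k₀ →
      ∑ i, residue r (a i * k) ≥ residue r (e * k) + r) →
    (k₀ : ℝ) / r ≤ 1 - c := by
  -- Six signed terms make up the defect, so an error below 1/6 in each keeps its change below r.
  obtain ⟨M, hM⟩ := exists_bounded_return_time 6 (ε := 1 / 6) (by norm_num)
  refine ⟨1 / (M + 1), by positivity, fun r a e k₀ hr hk1 hkr h0 hk => ?_⟩
  have hr' : (0 : ℝ) < r := by positivity
  obtain ⟨m, hm1, hmM, hm⟩ := hM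
    ![(a 0 * k₀ : ℤ) / r, (a 1 * k₀ : ℤ) / r, (a 2 * k₀ : ℤ) / r, (a 3 * k₀ : ℤ) / r,
      (e * k₀ : ℤ) / r, (k₀ : ℤ) / r]
  by_contra! hcon
  have hsmall : ((M : ℤ) + 1) * (r - k₀) < r := by
    have : ((M : ℝ) + 1) * (r - k₀) < r := by
      have hM1 : (0 : ℝ) < M + 1 := by positivity
      rw [lt_div_iff₀ hr'] at hcon
      have h : (M + 1) * (1 / (M + 1)) = (1 : ℝ) := by field_simp
      nlinarith
    exact_mod_cast this
  -- Modulo r, j * k₀ is -j(r - k₀), and 0 < j(r - k₀) < r. The case j = m + 1 gives k ≠ 0, the case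
  -- j = m gives k ≠ k₀.
  have hndvd : ∀ j : ℕ, 1 ≤ j → j ≤ M + 1 → ¬ (r : ℤ) ∣ j * k₀ := by
    intro j hj1 hjM hdvd
    have h1 : (r : ℤ) ∣ j * (r - k₀) := by
      rw [mul_sub]; exact dvd_sub (Dvd.intro_left _ rfl) hdvd
    have h2 := Int.le_of_dvd (by apply mul_pos <;> omega) h1
    have h3 : (j : ℤ) * (r - k₀) ≤ (M + 1) * (r - k₀) :=
      mul_le_mul_of_nonneg_right (by omega) (by omega)
    omega
  set k : ℕ := ((m + 1) * k₀) % r with hkdef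
  have hkr : k < r := Nat.mod_lt _ hr
  have hk0 : 1 ≤ k := by
    by_contra! h
    have : r ∣ (m + 1) * k₀ := Nat.dvd_of_mod_eq_zero (by omega)
    exact hndvd (m + 1) (by omega) (by omega) (by exact_mod_cast this)
  have hkk : (r : ℤ) ∣ (m + 1) * k₀ - k := by
    have := Int.dvd_self_sub_emod (x := ((m + 1) * k₀ : ℤ)) (m := r)
    simpa [hkdef] using this
  have hkne : k ≠ k₀ := by
    intro h
    rw [h] at hkk
    refine hndvd m hm1 (by omega) ?_
    convert hkk using 1; ring
  have hk := hk k hk0 hkr hkne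
  have hres : ∀ n : ℤ, (r : ℤ) ∣ residue r n - n := fun n => by
    have := Int.dvd_self_sub_emod (x := n) (m := r)
    rw [← dvd_neg]; simpa [residue] using this
  have hfr : ∀ n : ℤ, Int.fract (((m : ℝ) + 1) * (((n * k₀ : ℤ) : ℝ) / r)) =
      (residue r (n * k) : ℝ) / r := by
    intro n
    rw [residue_div_eq_fract hr, Int.fract_eq_fract]
    obtain ⟨z, hz⟩ := hkk
    have hz' : ((m : ℝ) + 1) * k₀ - k = r * z := by exact_mod_cast hz
    refine ⟨n * z, ?_⟩
    push_cast
    field_simp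
    linear_combination (n : ℝ) * hz'
  have hfr0 : ∀ n : ℤ, Int.fract (((n * k₀ : ℤ) : ℝ) / r) = (residue r (n * k₀) : ℝ) / r :=
    fun n => (residue_div_eq_fract hr _).symm
  have hone : ∀ l : ℕ, l < r → residue r (1 * l) = l := fun l hl => by
    rw [one_mul]; exact Int.emod_eq_of_lt (by omega) (by omega)
  have hb : ∀ n : ℤ, |Int.fract (((m : ℝ) + 1) * (((n * k₀ : ℤ) : ℝ) / r)) -
      Int.fract (((n * k₀ : ℤ) : ℝ) / r)| < 1 / 6 →
      6 * |residue r (n * k) - residue r (n * k₀)| < r := by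
    intro n h
    rw [hfr, hfr0, ← sub_div, abs_div, abs_of_pos hr', div_lt_iff₀ hr'] at h
    have : (6 : ℝ) * |(residue r (n * k) : ℝ) - residue r (n * k₀)| < r := by linarith
    exact_mod_cast this
  have b0 := hb _ (hm 0)
  have b1 := hb _ (hm 1)
  have b2 := hb _ (hm 2)
  have b3 := hb _ (hm 3)
  have b4 := hb _ (hm 4)
  have b5 := hb 1 (by simpa using hm 5)
  rw [hone k hkr, hone k₀ ‹_›] at b5
  simp only [Fin.sum_univ_four] at h0 hk
  -- The equation at k₀ gives r ∣ (∑ aᵢ - e - 1)k₀; multiply by m + 1 and use k ≡ (m+1)k₀.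
  have hd : (r : ℤ) ∣ residue r (a 0 * k) + residue r (a 1 * k) + residue r (a 2 * k) +
      residue r (a 3 * k) - residue r (e * k) - k := by
    have hz : (r : ℤ) ∣ (a 0 + a 1 + a 2 + a 3 - e - 1) * k₀ := by
      obtain ⟨c0, h0'⟩ := hres (a 0 * k₀)
      obtain ⟨c1, h1'⟩ := hres (a 1 * k₀)
      obtain ⟨c2, h2'⟩ := hres (a 2 * k₀)
      obtain ⟨c3, h3'⟩ := hres (a 3 * k₀)
      obtain ⟨c4, h4'⟩ := hres (e * k₀)
      exact ⟨c4 - c0 - c1 - c2 - c3, by linear_combination h0 - h0' - h1' - h2' - h3' + h4'⟩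
    obtain ⟨d, hd⟩ := hz
    obtain ⟨z, hz⟩ := hkk
    obtain ⟨c0, h0'⟩ := hres (a 0 * k)
    obtain ⟨c1, h1'⟩ := hres (a 1 * k)
    obtain ⟨c2, h2'⟩ := hres (a 2 * k)
    obtain ⟨c3, h3'⟩ := hres (a 3 * k)
    obtain ⟨c4, h4'⟩ := hres (e * k)
    exact ⟨c0 + c1 + c2 + c3 - c4 + (m + 1) * d - z * (a 0 + a 1 + a 2 + a 3 - e - 1), by
      linear_combination h0' + h1' + h2' + h3' - h4' + (m + 1 : ℤ) * hd -
        (a 0 + a 1 + a 2 + a 3 - e - 1) * hz⟩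
  have hlt : ∀ x : ℤ, 6 * |x| < r → 6 * x < r ∧ -(r : ℤ) < 6 * x := fun x hx =>
    ⟨by linarith [le_abs_self x], by linarith [neg_abs_le x]⟩
  -- The defect vanishes at k₀ and changes by less than r, so it vanishes at k too. But `hk` makes
  -- it at least r - k > 0.
  have h00 := Int.eq_zero_of_abs_lt_dvd hd (by
    rw [abs_lt]
    obtain ⟨u0, l0⟩ := hlt _ b0
    obtain ⟨u1, l1⟩ := hlt _ b1
    obtain ⟨u2, l2⟩ := hlt _ b2
    obtain ⟨u3, l3⟩ := hlt _ b3
    obtain ⟨u4, l4⟩ := hlt _ b4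
    obtain ⟨u5, l5⟩ := hlt _ b5
    constructor <;> linarith)
  linarith [(Int.ofNat_lt.2 hkr : (k : ℤ) < r)]

noncomputable section

/-! ### Orders along a discrete valuation ring -/

section Orders

variable {K : Type*} [Field K] [Algebra ℂ K] (V : Subalgebra ℂ K)

/-- `x` is a unit of `V` times `ϖ ^ k`. -/
def HasOrd (ϖ x : K) (k : ℤ) : Prop :=
  ∃ u : Vˣ, x = ((u : V) : K) * ϖ ^ k

variable {V}

theorem coe_unit_ne_zero (u : Vˣ) : ((u : V) : K) ≠ 0 := by
  simp

theorem coe_unit_zpow (u : Vˣ) (k : ℤ) : (((u ^ k : Vˣ) : V) : K) = ((u : V) : K) ^ k := by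
  have := congrArg Units.val (map_zpow (Units.map (V.val : V →* K)) u k)
  rwa [Units.val_zpow_eq_zpow_val] at this

theorem coe_unit_inv (u : Vˣ) : (((u⁻¹ : Vˣ) : V) : K) = ((u : V) : K)⁻¹ := by
  simpa using coe_unit_zpow u (-1)

theorem exists_unit_of_mem {x : K} (hx : x ≠ 0) (h : x ∈ V) (h' : x⁻¹ ∈ V) :
    ∃ u : Vˣ, ((u : V) : K) = x :=
  ⟨⟨⟨x, h⟩, ⟨x⁻¹, h'⟩, by ext; simp [hx], by ext; simp [hx]⟩, rfl⟩

namespace HasOrd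

variable {ϖ x y : K} {k l : ℤ}

theorem ne_zero (hϖ : ϖ ≠ 0) (h : HasOrd V ϖ x k) : x ≠ 0 := by
  obtain ⟨u, rfl⟩ := h
  exact mul_ne_zero (coe_unit_ne_zero u) (zpow_ne_zero _ hϖ)

theorem mul (hϖ : ϖ ≠ 0) (hx : HasOrd V ϖ x k) (hy : HasOrd V ϖ y l) :
    HasOrd V ϖ (x * y) (k + l) := by
  obtain ⟨u, rfl⟩ := hx
  obtain ⟨v, rfl⟩ := hy
  refine ⟨u * v, ?_⟩
  rw [zpow_add₀ hϖ]
  push_cast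
  ring

theorem zpow (hx : HasOrd V ϖ x k) (n : ℤ) : HasOrd V ϖ (x ^ n) (n * k) := by
  obtain ⟨u, rfl⟩ := hx
  refine ⟨u ^ n, ?_⟩
  rw [mul_zpow, ← zpow_mul, coe_unit_zpow, mul_comm k]

theorem pow (hx : HasOrd V ϖ x k) (n : ℕ) : HasOrd V ϖ (x ^ n) (n * k) := by
  simpa using hx.zpow n

theorem inv (hx : HasOrd V ϖ x k) : HasOrd V ϖ x⁻¹ (-k) := by
  simpa using hx.zpow (-1)

theorem of_unit (hx : ∃ u : Vˣ, ((u : V) : K) = x) : HasOrd V ϖ x 0 := by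
  obtain ⟨u, rfl⟩ := hx
  exact ⟨u, by simp⟩

theorem exists_unit (hx : HasOrd V ϖ x 0) : ∃ u : Vˣ, ((u : V) : K) = x := by
  obtain ⟨u, rfl⟩ := hx
  exact ⟨u, by simp⟩

theorem self : HasOrd V ϖ ϖ 1 := ⟨1, by simp⟩

end HasOrd

/-- A negative power of ϖ lying in `V` would make ϖ a unit. Uniqueness of orders follows from this.
-/
theorem hasOrd_mem_iff {ϖ : V} (hϖ : Irreducible ϖ) {x : K} {k : ℤ}
    (h : HasOrd V (ϖ : K) x k) : x ∈ V ↔ 0 ≤ k := by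
  obtain ⟨u, rfl⟩ := h
  have hϖ0 : (ϖ : K) ≠ 0 := by simpa using hϖ.ne_zero
  constructor
  · intro hx
    by_contra! hk
    obtain ⟨n, rfl⟩ : ∃ n : ℕ, k = -(n + 1) := ⟨(-k - 1).toNat, by omega⟩
    refine hϖ.not_isUnit (IsUnit.of_mul_eq_one
      (ϖ ^ n * ((u⁻¹ : Vˣ) : V) * ⟨_, hx⟩) ?_)
    ext
    push_cast
    have e : (ϖ : K) ^ (-((n : ℤ) + 1)) = ((ϖ : K) ^ (n + 1))⁻¹ := by
      rw [zpow_neg]; norm_cast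
    rw [coe_unit_inv, e]
    have := coe_unit_ne_zero u
    field_simp
    ring
  · intro hk
    obtain ⟨n, rfl⟩ := Int.eq_ofNat_of_zero_le hk
    have := (((u : V) * ϖ ^ n : V)).2
    simpa using this

theorem HasOrd.unique {ϖ : V} (hϖ : Irreducible ϖ) {x : K} {k l : ℤ}
    (h : HasOrd V (ϖ : K) x k) (h' : HasOrd V (ϖ : K) x l) : k = l := by
  have hϖ0 : (ϖ : K) ≠ 0 := by simpa using hϖ.ne_zero
  have hx := h.ne_zero hϖ0
  have a := (hasOrd_mem_iff hϖ (h.mul hϖ0 h'.inv)).1 (by rw [mul_inv_cancel₀ hx]; exact V.one_mem)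
  have b := (hasOrd_mem_iff hϖ (h'.mul hϖ0 h.inv)).1 (by rw [mul_inv_cancel₀ hx]; exact V.one_mem)
  omega

theorem exists_hasOrd [IsDiscreteValuationRing V] [IsFractionRing V K] {ϖ : V} (hϖ : Irreducible ϖ) {x : K} (hx : x ≠ 0) :
    ∃ k : ℤ, HasOrd V (ϖ : K) x k := by
  obtain ⟨n, u, rfl⟩ :=
    IsDiscreteValuationRing.exists_units_eq_smul_zpow_of_irreducible (K := K) hϖ hx
  exact ⟨n, u, rfl⟩

/-- Uniformizers differ by units, so the one hidden in `HasOrderAlong` can be traded for any other.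
-/
theorem HasOrderAlong.span_eq [IsDiscreteValuationRing V] {M : Type*} [AddCommGroup M] [Module K M] {L : Submodule V M}
    {x : M} {k : ℤ} (h : HasOrderAlong V L x k) {ϖ : V} (hϖ : Irreducible ϖ) :
    Submodule.span V {((ϖ : K) ^ (-k)) • x} = L := by
  obtain ⟨π, hπ, rfl⟩ := h
  obtain ⟨u, rfl⟩ := IsDiscreteValuationRing.associated_of_irreducible V hπ hϖ
  have : ((π * u : V) : K) ^ (-k) • x = ((u ^ (-k) : Vˣ) : V) • ((π : K) ^ (-k) • x) := by
    rw [Subalgebra.smul_def, coe_unit_zpow, smul_smul]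
    push_cast
    rw [mul_zpow, mul_comm]
  rw [this, Submodule.span_singleton_smul_eq (Units.isUnit _)]

theorem exists_unit_smul_of_span_eq {M : Type*} [AddCommGroup M] [Module K M] {x y : M}
    (h : Submodule.span V {x} = Submodule.span V {y}) (hx : x ≠ 0) :
    ∃ u : Vˣ, y = ((u : V) : K) • x := by
  obtain ⟨a, ha⟩ := Submodule.mem_span_singleton.1 (h ▸ Submodule.mem_span_singleton_self x)
  obtain ⟨b, hb⟩ := Submodule.mem_span_singleton.1 (h ▸ Submodule.mem_span_singleton_self y)
  have hab : a * b = 1 := by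
    rw [← ha] at hx
    have : ((a * b : V) : K) • x = (1 : K) • x := by
      rw [one_smul, ← Subalgebra.smul_def, mul_smul, hb, ha]
    have := smul_left_injective K (by rw [← ha]; exact hx : x ≠ 0) this
    exact Subtype.ext (by simpa using this)
  exact ⟨⟨b, a, by rw [mul_comm, hab], hab⟩, hb.symm⟩

theorem hasFunctionOrder_iff [IsDiscreteValuationRing V] {ϖ : V} (hϖ : Irreducible ϖ) {g : K} {k : ℤ} :
    HasFunctionOrder V g k ↔ HasOrd V (ϖ : K) g k := by
  have hϖ0 : (ϖ : K) ≠ 0 := by simpa using hϖ.ne_zero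
  constructor
  · intro h
    obtain ⟨u, hu⟩ := exists_unit_smul_of_span_eq (h.span_eq hϖ).symm one_ne_zero
    refine ⟨u, ?_⟩
    simp only [smul_eq_mul, mul_one, zpow_neg] at hu
    field_simp at hu
    rw [hu, mul_comm]
  · rintro ⟨u, rfl⟩
    refine ⟨ϖ, hϖ, ?_⟩
    have : (ϖ : K) ^ (-k) • (((u : V) : K) * (ϖ : K) ^ k) = (u : V) • (1 : K) := by
      rw [Subalgebra.smul_def, smul_eq_mul, smul_eq_mul, zpow_neg]
      field_simp
    rw [this, Submodule.span_singleton_smul_eq (Units.isUnit _)]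

/-- If `L` is generated by `y` and `x = c • y`, the order of `x` is that of `c`. -/
theorem hasOrderAlong_smul {M : Type*} [AddCommGroup M] [Module K M] {y : M} {ϖ : V}
    (hϖ : Irreducible ϖ) {c : K} {k : ℤ} (hc : HasOrd V (ϖ : K) c k) :
    HasOrderAlong V (Submodule.span V {y}) (c • y) k := by
  have hϖ0 : (ϖ : K) ≠ 0 := by simpa using hϖ.ne_zero
  obtain ⟨u, rfl⟩ := hc
  refine ⟨ϖ, hϖ, ?_⟩
  have : (ϖ : K) ^ (-k) • (((u : V) : K) * (ϖ : K) ^ k) • y = (u : V) • y := by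
    rw [Subalgebra.smul_def, smul_smul, zpow_neg]
    congr 1
    field_simp
  rw [this, Submodule.span_singleton_smul_eq (Units.isUnit _)]

/-- The orders of `x` and `h • x` differ by the order of `h`. -/
theorem HasOrderAlong.hasOrd_sub [IsDiscreteValuationRing V] {M : Type*} [AddCommGroup M] [Module K M] {L : Submodule V M}
    {x : M} {h : K} {k l : ℤ} (hx0 : x ≠ 0)
    (hx : HasOrderAlong V L x k) (hhx : HasOrderAlong V L (h • x) l)
    {ϖ : V} (hϖ : Irreducible ϖ) : HasOrd V (ϖ : K) h (l - k) := by
  have hϖ0 : (ϖ : K) ≠ 0 := by simpa using hϖ.ne_zero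
  obtain ⟨u, hu⟩ := exists_unit_smul_of_span_eq ((hx.span_eq hϖ).trans (hhx.span_eq hϖ).symm)
    (smul_ne_zero (zpow_ne_zero _ hϖ0) hx0)
  refine ⟨u, ?_⟩
  rw [smul_smul, smul_smul] at hu
  have := smul_left_injective K hx0 hu
  rw [zpow_neg, zpow_neg] at this
  rw [zpow_sub₀ hϖ0]
  field_simp at this ⊢
  linear_combination this

end Orders

/-! ### Wedge products and logarithmic forms -/

section LogForms

variable {K : Type*} [Field K] {E : Type*} [AddCommGroup E] [Module K E]

/-- The wedge product of three vectors. -/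
def wedge₃ (x y z : E) : ⋀[K]^3 E := exteriorPower.ιMulti K 3 ![x, y, z]

theorem wedge₃_eq (v : Fin 3 → E) :
    exteriorPower.ιMulti K 3 v = wedge₃ (K := K) (v 0) (v 1) (v 2) := by
  rw [wedge₃]; congr 1; ext i; fin_cases i <;> rfl

theorem update_vec_zero {α : Type*} (a x y z : α) :
    Function.update ![x, y, z] 0 a = ![a, y, z] := by
  ext i; fin_cases i <;> rfl

theorem wedge₃_add_left (x x' y z : E) :
    wedge₃ (K := K) (x + x') y z = wedge₃ x y z + wedge₃ x' y z := by
  have h := (exteriorPower.ιMulti K 3 (M := E)).map_update_add ![x, y, z] 0 x x'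
  rwa [update_vec_zero, update_vec_zero, update_vec_zero] at h

theorem wedge₃_smul_left (c : K) (x y z : E) :
    wedge₃ (K := K) (c • x) y z = c • wedge₃ x y z := by
  have h := (exteriorPower.ιMulti K 3 (M := E)).map_update_smul ![x, y, z] 0 c x
  rwa [update_vec_zero, update_vec_zero] at h

theorem wedge₃_swap_left (x y z : E) : wedge₃ (K := K) y x z = -wedge₃ x y z := by
  have := (exteriorPower.ιMulti K 3 (M := E)).map_swap ![x, y, z] (i := 0) (j := 1) (by decide)
  rw [wedge₃, wedge₃, ← this]
  congr 1; ext i; fin_cases i <;> rfl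

theorem wedge₃_swap_right (x y z : E) : wedge₃ (K := K) x z y = -wedge₃ x y z := by
  have := (exteriorPower.ιMulti K 3 (M := E)).map_swap ![x, y, z] (i := 1) (j := 2) (by decide)
  rw [wedge₃, wedge₃, ← this]
  congr 1; ext i; fin_cases i <;> rfl

theorem wedge₃_add_mid (x y y' z : E) :
    wedge₃ (K := K) x (y + y') z = wedge₃ x y z + wedge₃ x y' z := by
  rw [wedge₃_swap_left, wedge₃_add_left, wedge₃_swap_left, wedge₃_swap_left y']
  abel

theorem wedge₃_smul_mid (c : K) (x y z : E) :
    wedge₃ (K := K) x (c • y) z = c • wedge₃ x y z := by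
  rw [wedge₃_swap_left, wedge₃_smul_left, wedge₃_swap_left, smul_neg]; abel

theorem wedge₃_add_right (x y z z' : E) :
    wedge₃ (K := K) x y (z + z') = wedge₃ x y z + wedge₃ x y z' := by
  rw [wedge₃_swap_right, wedge₃_add_mid, wedge₃_swap_right, wedge₃_swap_right x z']
  abel

theorem wedge₃_smul_right (c : K) (x y z : E) :
    wedge₃ (K := K) x y (c • z) = c • wedge₃ x y z := by
  rw [wedge₃_swap_right, wedge₃_smul_mid, wedge₃_swap_right, smul_neg]; abel

theorem wedge₃_self_left (x z : E) : wedge₃ (K := K) x x z = 0 :=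
  (exteriorPower.ιMulti K 3 (M := E)).map_eq_zero_of_eq ![x, x, z] (i := 0) (j := 1) rfl (by decide)

theorem wedge₃_self_right (x y : E) : wedge₃ (K := K) x y y = 0 :=
  (exteriorPower.ιMulti K 3 (M := E)).map_eq_zero_of_eq ![x, y, y] (i := 1) (j := 2) rfl (by decide)

theorem wedge₃_self_outer (x y : E) : wedge₃ (K := K) x y x = 0 :=
  (exteriorPower.ιMulti K 3 (M := E)).map_eq_zero_of_eq ![x, y, x] (i := 0) (j := 2) rfl (by decide)

/-- A wedge product of three combinations of three fixed vectors. -/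
theorem wedge₃_mem_span {V : Type*} [CommRing V] [Algebra V K] [Module V E] [IsScalarTower V K E]
    {e₀ e₁ e₂ x y z : E}
    (hx : x ∈ Submodule.span V {e₀, e₁, e₂}) (hy : y ∈ Submodule.span V {e₀, e₁, e₂})
    (hz : z ∈ Submodule.span V {e₀, e₁, e₂}) :
    wedge₃ (K := K) x y z ∈ Submodule.span V {wedge₃ (K := K) e₀ e₁ e₂} := by
  rw [Submodule.mem_span_triple] at hx hy hz
  obtain ⟨x0, x1, x2, rfl⟩ := hx
  obtain ⟨y0, y1, y2, rfl⟩ := hy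
  obtain ⟨z0, z1, z2, rfl⟩ := hz
  -- The coefficient is the 3×3 determinant, expanded along the row of `x`.
  refine Submodule.mem_span_singleton.2 ⟨x0 * (y1 * z2 - y2 * z1) - x1 * (y0 * z2 - y2 * z0) +
    x2 * (y0 * z1 - y1 * z0), ?_⟩
  simp only [← algebraMap_smul K (_ : V) (_ : E), ← algebraMap_smul K (_ : V) (_ : ⋀[K]^3 E)]
  simp only [wedge₃_add_left, wedge₃_add_mid, wedge₃_add_right, wedge₃_smul_left,
    wedge₃_smul_mid, wedge₃_smul_right, wedge₃_self_left, wedge₃_self_right, wedge₃_self_outer]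
  rw [wedge₃_swap_left e₀ e₁ e₂, wedge₃_swap_right e₀ e₁ e₂, wedge₃_swap_left e₀ e₂ e₁,
    wedge₃_swap_right e₀ e₁ e₂, wedge₃_swap_right e₁ e₀ e₂, wedge₃_swap_left e₀ e₁ e₂,
    wedge₃_swap_right e₂ e₀ e₁, wedge₃_swap_left e₀ e₂ e₁, wedge₃_swap_right e₀ e₁ e₂]
  simp only [map_add, map_sub, map_mul]
  module

variable [Algebra ℂ K] {V : Subalgebra ℂ K}

theorem wedge₃_D_mem_regularForms {x y z : K} (hx : x ∈ V) (hy : y ∈ V) (hz : z ∈ V) :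
    wedge₃ (KaehlerDifferential.D ℂ K x) (KaehlerDifferential.D ℂ K y)
      (KaehlerDifferential.D ℂ K z) ∈ regularForms V 3 := by
  refine Submodule.subset_span ⟨![⟨x, hx⟩, ⟨y, hy⟩, ⟨z, hz⟩], ?_⟩
  exact wedge₃_eq _

/-- The logarithmic derivative du/u + n dt/t: its only possible pole is in the dt/t term. -/
theorem D_unit_mul_pow (u : Vˣ) (t : K) (ht : t ≠ 0) (n : ℕ) :
    KaehlerDifferential.D ℂ K (((u : V) : K) * t ^ n) = (((u : V) : K) * t ^ n) •
      (((u : V) : K)⁻¹ • KaehlerDifferential.D ℂ K ((u : V) : K) +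
        (n : K) • t⁻¹ • KaehlerDifferential.D ℂ K t) := by
  have hu := coe_unit_ne_zero u
  rw [Derivation.leibniz, Derivation.leibniz_pow]
  simp only [← Nat.cast_smul_eq_nsmul K, smul_add, smul_smul]
  rw [add_comm]
  congr 2
  · field_simp
  · rcases n with _ | n
    · simp
    · simp; field_simp; ring

/-- Logarithmic forms have at most simple poles. -/
theorem smul_logForm_mem_regularForms [IsDiscreteValuationRing V] {ϖ : V} (hϖ : Irreducible ϖ)
    {f : Fin 3 → K} (hf : ∀ i, f i ∈ V) (hf0 : ∀ i, f i ≠ 0) :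
    ((ϖ : K) * (f 0 * f 1 * f 2)⁻¹) • wedge₃ (KaehlerDifferential.D ℂ K (f 0))
      (KaehlerDifferential.D ℂ K (f 1)) (KaehlerDifferential.D ℂ K (f 2)) ∈ regularForms V 3 := by
  have hϖ0 : (ϖ : K) ≠ 0 := by simpa using hϖ.ne_zero
  have hfac : ∀ i, ∃ (u : Vˣ) (n : ℕ), f i = ((u : V) : K) * (ϖ : K) ^ n := by
    intro i
    obtain ⟨n, u, h⟩ := IsDiscreteValuationRing.eq_unit_mul_pow_irreducible
      (x := (⟨f i, hf i⟩ : V)) (by simpa [Subtype.ext_iff] using hf0 i) hϖ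
    exact ⟨u, n, by simpa using congrArg Subtype.val h⟩
  choose u n h using hfac
  have hD : ∀ i, KaehlerDifferential.D ℂ K (f i) = f i •
      (((u i : V) : K)⁻¹ • KaehlerDifferential.D ℂ K ((u i : V) : K) +
        (n i : K) • (ϖ : K)⁻¹ • KaehlerDifferential.D ℂ K (ϖ : K)) := by
    intro i
    conv_lhs => rw [h i]
    rw [D_unit_mul_pow _ _ hϖ0, ← h i]
  have hreg : ∀ x y z : V, wedge₃ (KaehlerDifferential.D ℂ K (x : K))
      (KaehlerDifferential.D ℂ K (y : K)) (KaehlerDifferential.D ℂ K (z : K)) ∈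
      regularForms V 3 := fun x y z => wedge₃_D_mem_regularForms x.2 y.2 z.2
  -- Terms with two factors dϖ vanish, so four survive, each with at most one ϖ⁻¹, which the factor
  -- ϖ in front cancels.
  have hmem := add_mem (add_mem (add_mem
    ((regularForms V 3).smul_mem (ϖ * ((u 0)⁻¹ : Vˣ) * ((u 1)⁻¹ : Vˣ) * ((u 2)⁻¹ : Vˣ))
      (hreg (u 0) (u 1) (u 2)))
    ((regularForms V 3).smul_mem ((n 0 : V) * ((u 1)⁻¹ : Vˣ) * ((u 2)⁻¹ : Vˣ))
      (hreg ϖ (u 1) (u 2))))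
    ((regularForms V 3).smul_mem ((n 1 : V) * ((u 0)⁻¹ : Vˣ) * ((u 2)⁻¹ : Vˣ))
      (hreg (u 0) ϖ (u 2))))
    ((regularForms V 3).smul_mem ((n 2 : V) * ((u 0)⁻¹ : Vˣ) * ((u 1)⁻¹ : Vˣ))
      (hreg (u 0) (u 1) ϖ))
  have h0 := hf0 0
  have h1 := hf0 1
  have h2 := hf0 2
  have hu0 := coe_unit_ne_zero (u 0)
  have hu1 := coe_unit_ne_zero (u 1)
  have hu2 := coe_unit_ne_zero (u 2)
  convert hmem using 1
  rw [hD 0, hD 1, hD 2]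
  simp only [wedge₃_add_left, wedge₃_add_mid, wedge₃_add_right, wedge₃_smul_left,
    wedge₃_smul_mid, wedge₃_smul_right, wedge₃_self_left, wedge₃_self_right, wedge₃_self_outer,
    Subalgebra.smul_def]
  push_cast
  simp only [coe_unit_inv]
  match_scalars <;> field_simp

end LogForms

/-! ### The local ring at a prime element -/

section PrimeLocal

set_option linter.unusedSectionVars false

variable {B K : Type*} [CommRing B] [IsDomain B] [Algebra ℂ B] [Field K] [Algebra ℂ K]
  (ψ : B →ₐ[ℂ] K) (hψ : Function.Injective ψ) {π : B} (hπ : Prime π)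

include hψ in
theorem map_ne_zero_of_not_dvd {s : B} (h : ¬ π ∣ s) : ψ s ≠ 0 := by
  intro h0
  rw [map_eq_zero_iff ψ hψ] at h0
  exact h (h0 ▸ dvd_zero π)

/-- The local ring of `B` at the prime element `π`, inside a field containing `B`. -/
def primeLocal : Subalgebra ℂ K where
  carrier := {x | ∃ a s : B, ¬ π ∣ s ∧ x = ψ a / ψ s}
  mul_mem' := by
    rintro _ _ ⟨a, s, hs, rfl⟩ ⟨b, t, ht, rfl⟩
    refine ⟨a * b, s * t, hπ.not_dvd_mul hs ht, ?_⟩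
    rw [map_mul, map_mul]
    ring
  add_mem' := by
    rintro _ _ ⟨a, s, hs, rfl⟩ ⟨b, t, ht, rfl⟩
    refine ⟨a * t + b * s, s * t, hπ.not_dvd_mul hs ht, ?_⟩
    have h1 := map_ne_zero_of_not_dvd ψ hψ hs
    have h2 := map_ne_zero_of_not_dvd ψ hψ ht
    rw [map_add, map_mul, map_mul, map_mul]
    field_simp
  algebraMap_mem' c := ⟨algebraMap ℂ B c, 1, hπ.not_dvd_one, by simp⟩

variable {ψ}

theorem mem_primeLocal {x : K} :
    x ∈ primeLocal ψ hψ hπ ↔ ∃ a s : B, ¬ π ∣ s ∧ x = ψ a / ψ s := Iff.rfl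

theorem map_mem_primeLocal (b : B) : ψ b ∈ primeLocal ψ hψ hπ :=
  ⟨b, 1, hπ.not_dvd_one, by simp⟩

theorem exists_unit_primeLocal {b : B} (hb : ¬ π ∣ b) :
    ∃ u : (primeLocal ψ hψ hπ)ˣ, ((u : primeLocal ψ hψ hπ) : K) = ψ b :=
  exists_unit_of_mem (map_ne_zero_of_not_dvd ψ hψ hb) (map_mem_primeLocal hψ hπ b)
    ⟨1, b, hb, by simp⟩

theorem not_dvd_of_unit_primeLocal {b : B}
    (h : ∃ u : (primeLocal ψ hψ hπ)ˣ, ((u : primeLocal ψ hψ hπ) : K) = ψ b) : ¬ π ∣ b := by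
  obtain ⟨u, hu⟩ := h
  obtain ⟨a, s, hs, has⟩ := ((u⁻¹ : (primeLocal ψ hψ hπ)ˣ) : primeLocal ψ hψ hπ).2
  rw [coe_unit_inv, hu] at has
  have hs0 := map_ne_zero_of_not_dvd ψ hψ hs
  have hb0 : ψ b ≠ 0 := hu ▸ coe_unit_ne_zero u
  field_simp at has
  rw [← map_mul] at has
  intro hb
  exact hs (hψ has ▸ dvd_mul_of_dvd_left hb a)

/-- The prime element as an element of the local ring. -/
def primeLocalUniformizer : primeLocal ψ hψ hπ := ⟨ψ π, map_mem_primeLocal hψ hπ π⟩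

theorem irreducible_primeLocalUniformizer : Irreducible (primeLocalUniformizer hψ hπ) := by
  constructor
  · intro h
    exact not_dvd_of_unit_primeLocal hψ hπ ⟨h.unit, rfl⟩ dvd_rfl
  · rintro ⟨_, a, s, hs, rfl⟩ ⟨_, b, t, ht, rfl⟩ h
    have hs0 := map_ne_zero_of_not_dvd ψ hψ hs
    have ht0 := map_ne_zero_of_not_dvd ψ hψ ht
    have unit : ∀ {a s : B} (hs : ¬ π ∣ s), ¬ π ∣ a →
        IsUnit (⟨ψ a / ψ s, a, s, hs, rfl⟩ : primeLocal ψ hψ hπ) := by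
      intro a s hs ha
      have hs0 := map_ne_zero_of_not_dvd ψ hψ hs
      have ha0 := map_ne_zero_of_not_dvd ψ hψ ha
      exact IsUnit.of_mul_eq_one ⟨ψ s / ψ a, s, a, ha, rfl⟩ (by ext; push_cast; field_simp)
    have h' : ψ π = ψ a / ψ s * (ψ b / ψ t) := congrArg Subtype.val h
    field_simp at h'
    simp only [← map_mul] at h'
    have h' := hψ h'
    by_contra! hcon
    obtain ⟨a, rfl⟩ : π ∣ a := by
      by_contra ha
      exact hcon.1 (unit hs ha)
    obtain ⟨b, rfl⟩ : π ∣ b := by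
      by_contra hb
      exact hcon.2 (unit ht hb)
    have : s * t = π * (a * b) := mul_left_cancel₀ hπ.ne_zero (by linear_combination h')
    exact hπ.not_dvd_mul hs ht ⟨_, this⟩

/-- Extract the highest power of π from the numerator; what remains is a quotient of elements prime
to π, hence a unit. -/
theorem isDiscreteValuationRing_primeLocal [UniqueFactorizationMonoid B] :
    IsDiscreteValuationRing (primeLocal ψ hψ hπ) := by
  refine IsDiscreteValuationRing.ofHasUnitMulPowIrreducibleFactorization
    ⟨_, irreducible_primeLocalUniformizer hψ hπ, ?_⟩
  rintro ⟨_, a, s, hs, rfl⟩ hx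
  have ha : a ≠ 0 := by
    rintro rfl
    exact hx (by ext; simp)
  obtain ⟨n, b, hb, rfl⟩ := WfDvdMonoid.max_power_factor ha hπ.irreducible
  refine ⟨n, ?_⟩
  obtain ⟨u, hu⟩ := exists_unit_primeLocal hψ hπ hb
  obtain ⟨v, hv⟩ := exists_unit_primeLocal hψ hπ hs
  refine ⟨u * v⁻¹, ?_⟩
  ext
  push_cast
  rw [coe_unit_inv, hu, hv, primeLocalUniformizer, map_mul, map_pow]
  push_cast
  ring

theorem isFractionRing_primeLocal (hfrac : ∀ x : K, ∃ a b : B, x = ψ a / ψ b) :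
    IsFractionRing (primeLocal ψ hψ hπ) K := by
  refine IsFractionRing.of_field (primeLocal ψ hψ hπ) K fun x => ?_
  obtain ⟨a, b, rfl⟩ := hfrac x
  exact ⟨⟨_, map_mem_primeLocal hψ hπ a⟩, ⟨_, map_mem_primeLocal hψ hπ b⟩, rfl⟩

theorem essFiniteType_primeLocal [Algebra.FiniteType ℂ B] :
    Algebra.EssFiniteType ℂ (primeLocal ψ hψ hπ) := by
  classical
  let φ : B →ₐ[ℂ] primeLocal ψ hψ hπ := ψ.codRestrict _ (map_mem_primeLocal hψ hπ)
  obtain ⟨σ, hσ⟩ := (Algebra.FiniteType.out : (⊤ : Subalgebra ℂ B).FG)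
  have hmem : ∀ b, φ b ∈ Algebra.adjoin ℂ ((σ.image φ : Finset _) : Set (primeLocal ψ hψ hπ)) := by
    intro b
    rw [Finset.coe_image, ← AlgHom.map_adjoin, hσ]
    exact ⟨b, trivial, rfl⟩
  rw [Algebra.essFiniteType_iff]
  refine ⟨σ.image φ, ?_⟩
  rintro ⟨_, a, s, hs, rfl⟩
  refine ⟨φ s, hmem s, ?_, ?_⟩
  · obtain ⟨u, hu⟩ := exists_unit_primeLocal hψ hπ hs
    exact ⟨u, Subtype.ext hu⟩
  · convert hmem a
    ext
    have hs0 := map_ne_zero_of_not_dvd ψ hψ hs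
    change ψ a / ψ s * ψ s = ψ a
    field_simp

end PrimeLocal

/-! ### Factorial charts and height one primes -/

section Charts

set_option linter.unusedSectionVars false

variable {A B : Type*} [CommRing A] [IsDomain A] [Algebra ℂ A]
  [CommRing B] [IsDomain B] [Algebra ℂ B]

theorem mem_localRingAt {P : Ideal A} [P.IsPrime] {x : FractionRing A} :
    x ∈ localRingAt A P ↔ ∃ a s : A, s ∉ P ∧
      x = algebraMap A (FractionRing A) a / algebraMap A (FractionRing A) s := by
  constructor
  · rintro ⟨a, s, hs, rfl⟩
    exact ⟨a, s, hs, by rw [div_eq_mul_inv]⟩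
  · rintro ⟨a, s, hs, rfl⟩
    exact ⟨a, s, hs, by rw [div_eq_mul_inv]⟩

/-- `ψ` identifies `Spec B` with an affine chart of a modification of `Spec A` that is an
isomorphism outside `w = 0`. -/
structure IsChart (ψ : B →ₐ[ℂ] FractionRing A) (w : A) : Prop where
  injective : Function.Injective ψ
  exists_eq : ∀ a : A, ∃ b, ψ b = algebraMap A (FractionRing A) a
  exists_pow : ∀ b, ∃ (n : ℕ) (a : A),
    algebraMap A (FractionRing A) w ^ n * ψ b = algebraMap A (FractionRing A) a
  ne_zero : w ≠ 0

namespace IsChart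

variable {ψ : B →ₐ[ℂ] FractionRing A} {w : A} (h : IsChart ψ w)
include h

/-- The inclusion of coordinate rings of a chart. -/
def hom : A →ₐ[ℂ] B :=
  (AlgEquiv.ofInjective ψ h.injective).symm.toAlgHom.comp
    ((IsScalarTower.toAlgHom ℂ A (FractionRing A)).codRestrict ψ.range fun a => h.exists_eq a)

theorem map_hom (a : A) : ψ (h.hom a) = algebraMap A (FractionRing A) a := by
  have := AlgEquiv.apply_symm_apply (AlgEquiv.ofInjective ψ h.injective)
    ((IsScalarTower.toAlgHom ℂ A (FractionRing A)).codRestrict ψ.range (fun a => h.exists_eq a) a)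
  exact congrArg Subtype.val this

theorem exists_hom_eq (b : B) : ∃ (n : ℕ) (a : A), h.hom a = h.hom w ^ n * b := by
  obtain ⟨n, a, e⟩ := h.exists_pow b
  refine ⟨n, a, h.injective ?_⟩
  rw [map_hom, ← e, map_mul, map_pow, map_hom]

theorem hom_injective : Function.Injective h.hom := by
  intro a b e
  apply IsFractionRing.injective A (FractionRing A)
  rw [← h.map_hom, e, h.map_hom]

theorem exists_div (x : FractionRing A) : ∃ a b : B, x = ψ a / ψ b := by
  obtain ⟨a, b, _, rfl⟩ := IsFractionRing.div_surjective (A := A) x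
  exact ⟨h.hom a, h.hom b, by rw [h.map_hom, h.map_hom]⟩

/-- The prime ideal of `A` defined by a prime element on the chart. -/
def primeIdeal (π : B) : Ideal A := (Ideal.span {π}).comap h.hom

theorem mem_primeIdeal {π : B} {a : A} : a ∈ h.primeIdeal π ↔ π ∣ h.hom a := by
  rw [primeIdeal, Ideal.mem_comap, Ideal.mem_span_singleton]

theorem isPrime_primeIdeal {π : B} (hπ : Prime π) : (h.primeIdeal π).IsPrime := by
  have := (Ideal.span_singleton_prime hπ.ne_zero).2 hπ
  exact Ideal.comap_isPrime _ _

theorem primeIdeal_ne_bot {π : B} (hπ : Prime π) : h.primeIdeal π ≠ ⊥ := by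
  obtain ⟨n, a, e⟩ := h.exists_hom_eq π
  intro hbot
  have ha : a ∈ h.primeIdeal π := h.mem_primeIdeal.2 (e ▸ dvd_mul_left _ _)
  rw [hbot, Ideal.mem_bot] at ha
  rw [ha, map_zero] at e
  have hw : h.hom w ≠ 0 := (map_ne_zero_iff _ h.hom_injective).2 h.ne_zero
  exact mul_ne_zero (pow_ne_zero n hw) hπ.ne_zero e.symm

/-- Powers of `w` carry elements of `B` into `A`, and they are units at π. -/
theorem localRingAt_eq {π : B} (hπ : Prime π) (hw : ¬ π ∣ h.hom w) {P : Ideal A} [P.IsPrime]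
    (hP : P = h.primeIdeal π) : localRingAt A P = primeLocal ψ h.injective hπ := by
  subst hP
  ext x
  rw [mem_localRingAt, mem_primeLocal]
  constructor
  · rintro ⟨a, s, hs, rfl⟩
    exact ⟨h.hom a, h.hom s, fun hd => hs (h.mem_primeIdeal.2 hd), by rw [h.map_hom, h.map_hom]⟩
  · rintro ⟨a, s, hs, rfl⟩
    obtain ⟨n, a', ea⟩ := h.exists_hom_eq a
    obtain ⟨m, s', es⟩ := h.exists_hom_eq s
    refine ⟨w ^ m * a', w ^ n * s', ?_, ?_⟩
    · rw [h.mem_primeIdeal, map_mul, map_pow, es]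
      exact hπ.not_dvd_mul (mt hπ.dvd_of_dvd_pow hw)
        (hπ.not_dvd_mul (mt hπ.dvd_of_dvd_pow hw) hs)
    · rw [← h.map_hom, ← h.map_hom]
      simp only [map_mul, map_pow, ea, es]
      have h1 := map_ne_zero_of_not_dvd ψ h.injective hs
      have h2 := map_ne_zero_of_not_dvd ψ h.injective hw
      field_simp

/-- Factor a nonzero element of `P` in the factorial ring `B`. After multiplication by powers of
`w`, which avoid `P`, the factors lie in `A`, so one prime factor must fall into `P`. -/
theorem exists_primeIdeal_le [UniqueFactorizationMonoid B] {P : Ideal A} [P.IsPrime]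
    (hw : w ∉ P) (hP : P ≠ ⊥) :
    ∃ π : B, Prime π ∧ ¬ π ∣ h.hom w ∧ h.primeIdeal π ≤ P := by
  obtain ⟨p, hp, hp0⟩ := Submodule.exists_mem_ne_zero_of_ne_bot hP
  have key : ∀ b : B, b ≠ 0 → (∃ (n : ℕ) (a : A), h.hom a = h.hom w ^ n * b ∧ a ∈ P) →
      ∃ π : B, Prime π ∧ ∃ (n : ℕ) (a : A), h.hom a = h.hom w ^ n * π ∧ a ∈ P := by
    intro b
    refine UniqueFactorizationMonoid.induction_on_prime b (fun h0 => absurd rfl h0) ?_ ?_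
    · rintro b hb _ ⟨n, a, e, ha⟩
      obtain ⟨c, hc⟩ := hb.exists_right_inv
      obtain ⟨m, a', e'⟩ := h.exists_hom_eq c
      have : a * a' = w ^ (n + m) := by
        apply h.hom_injective
        rw [map_mul, map_pow, e, e']
        linear_combination h.hom w ^ (n + m) * hc
      exact absurd (Ideal.IsPrime.mem_of_pow_mem ‹_› _ (this ▸ P.mul_mem_right a' ha)) hw
    · rintro b π hb hπ ih _ ⟨n, a, e, ha⟩
      obtain ⟨m, a', e'⟩ := h.exists_hom_eq b
      obtain ⟨l, a'', e''⟩ := h.exists_hom_eq π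
      have : w ^ n * (a'' * a') = w ^ (l + m) * a := by
        apply h.hom_injective
        simp only [map_mul, map_pow, e, e', e'']
        ring
      have hmem : w ^ n * (a'' * a') ∈ P := this ▸ P.mul_mem_left _ ha
      rcases Ideal.IsPrime.mem_or_mem ‹_› hmem with h1 | h1
      · exact absurd (Ideal.IsPrime.mem_of_pow_mem ‹_› _ h1) hw
      rcases Ideal.IsPrime.mem_or_mem ‹_› h1 with h2 | h2
      · exact ⟨π, hπ, l, a'', e'', h2⟩
      · exact ih hb ⟨m, a', e', h2⟩
  obtain ⟨π, hπ, n, a, e, ha⟩ := key (h.hom p)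
    ((map_ne_zero_iff _ h.hom_injective).2 hp0) ⟨0, p, by simp, hp⟩
  have hle : h.primeIdeal π ≤ P := by
    intro c hc
    obtain ⟨b, hb⟩ := h.mem_primeIdeal.1 hc
    obtain ⟨m, a', e'⟩ := h.exists_hom_eq b
    have : w ^ (n + m) * c = a * a' := by
      apply h.hom_injective
      simp only [map_mul, map_pow, e, e', hb]
      ring
    have hmem : w ^ (n + m) * c ∈ P := this ▸ P.mul_mem_right _ ha
    exact (Ideal.IsPrime.mem_or_mem ‹_› hmem).resolve_left
      fun h1 => hw (Ideal.IsPrime.mem_of_pow_mem ‹_› _ h1)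
  exact ⟨π, hπ, fun hd => hw (hle (h.mem_primeIdeal.2 hd)), hle⟩

/-- Height one primes outside `w = 0` come from prime elements on the chart. -/
theorem exists_prime_of_height_eq_one [UniqueFactorizationMonoid B] {P : Ideal A} [P.IsPrime]
    (hP : P.height = 1) (hw : w ∉ P) :
    ∃ (π : B) (hπ : Prime π), ¬ π ∣ h.hom w ∧
      localRingAt A P = primeLocal ψ h.injective hπ := by
  obtain ⟨π, hπ, hd, hle⟩ := h.exists_primeIdeal_le hw (Ideal.ne_bot_of_height_eq_one hP)
  refine ⟨π, hπ, hd, h.localRingAt_eq hπ hd ?_⟩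
  have := h.isPrime_primeIdeal hπ
  by_contra hne
  have hlt := Ideal.height_le_iff.1 (show P.height ≤ (1 : ℕ) by simp [hP]) _ this
    (lt_of_le_of_ne hle (Ne.symm hne))
  have h0 : (h.primeIdeal π).height = 0 := by simpa [Order.lt_one_iff] using hlt
  exact h.primeIdeal_ne_bot hπ (Ideal.height_eq_zero_iff_eq_bot.1 h0)

/-- Prime elements on the chart not dividing `w` give height one primes. -/
theorem height_primeIdeal [UniqueFactorizationMonoid B] {π : B} (hπ : Prime π)
    (hw : ¬ π ∣ h.hom w) : (h.primeIdeal π).height = 1 := by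
  have := h.isPrime_primeIdeal hπ
  refine le_antisymm ?_ ?_
  · refine Ideal.height_le_iff.2 fun Q hQ hlt => ?_
    -- A nonzero `Q` would contain the contraction of some (π'). Then π' divides π, the two are
    -- associated, and `Q` is not strictly smaller.
    have hQ0 : Q = ⊥ := by
      by_contra hne
      obtain ⟨π', hπ', hd', hle⟩ := h.exists_primeIdeal_le
        (fun hwQ => hw (h.mem_primeIdeal.1 (hlt.le hwQ))) hne
      obtain ⟨n, a, e⟩ := h.exists_hom_eq π'
      have h1 := h.mem_primeIdeal.1 (hlt.le (hle (h.mem_primeIdeal.2 (e ▸ dvd_mul_left _ _))))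
      rw [e] at h1
      have h2 := (hπ.dvd_or_dvd h1).resolve_left (mt hπ.dvd_of_dvd_pow hw)
      have h3 : π' ∣ π := (hπ.associated_of_dvd hπ' h2).symm.dvd
      exact hlt.not_ge fun x hx => hle (h.mem_primeIdeal.2 (h3.trans (h.mem_primeIdeal.1 hx)))
    rw [hQ0, Ideal.height_bot]
    exact one_pos
  · rw [Order.one_le_iff_ne_zero, Ne, Ideal.height_eq_zero_iff_eq_bot]
    exact h.primeIdeal_ne_bot hπ

/-- An element of the fraction field without poles on the chart outside `w = 0`. -/
theorem exists_pow_mul_eq [UniqueFactorizationMonoid B] {x : FractionRing A}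
    (hx : ∀ (P : Ideal A) [P.IsPrime], P.height = 1 → x ∈ localRingAt A P) :
    ∃ (n : ℕ) (a : A),
      algebraMap A (FractionRing A) w ^ n * x = algebraMap A (FractionRing A) a := by
  have hx' : ∀ (π : B) (hπ : Prime π), ¬ π ∣ h.hom w → x ∈ primeLocal ψ h.injective hπ := by
    intro π hπ hd
    have := h.isPrime_primeIdeal hπ
    rw [← h.localRingAt_eq hπ hd rfl]
    exact hx _ (h.height_primeIdeal hπ hd)
  have hw0 : ψ (h.hom w) ≠ 0 := by
    rw [map_ne_zero_iff ψ h.injective]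
    exact (map_ne_zero_iff _ h.hom_injective).2 h.ne_zero
  -- Induction on the prime factors of the denominator: those dividing `w` are absorbed by a power
  -- of `w`, the others cancel against the numerator because there is no pole along them.
  have key : ∀ b : B, b ≠ 0 → ∀ a : B,
      (∀ (π : B) (hπ : Prime π), ¬ π ∣ h.hom w → ψ a / ψ b ∈ primeLocal ψ h.injective hπ) →
      ∃ (n : ℕ) (c : B), ψ (h.hom w) ^ n * (ψ a / ψ b) = ψ c := by
    intro b
    refine UniqueFactorizationMonoid.induction_on_prime b (fun h0 => absurd rfl h0) ?_ ?_
    · intro b hb _ a _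
      obtain ⟨c, hc⟩ := hb.exists_right_inv
      refine ⟨0, a * c, ?_⟩
      have hbc : ψ b * ψ c = 1 := by rw [← map_mul, hc, map_one]
      have hb0 : ψ b ≠ 0 := left_ne_zero_of_mul_eq_one hbc
      rw [map_mul]
      field_simp
      linear_combination -ψ a * hbc
    · intro b π hb hπ ih _ a ha
      have hb0 : ψ b ≠ 0 := (map_ne_zero_iff ψ h.injective).2 hb
      have hπ0 : ψ π ≠ 0 := (map_ne_zero_iff ψ h.injective).2 hπ.ne_zero
      by_cases hd : π ∣ h.hom w
      · obtain ⟨t, ht⟩ := hd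
        obtain ⟨n, c, hc⟩ := ih hb a (by
          intro π' hπ' hd'
          have := mul_mem (map_mem_primeLocal h.injective hπ' π) (ha π' hπ' hd')
          convert this using 1
          rw [map_mul]
          field_simp)
        refine ⟨n + 1, t * c, ?_⟩
        rw [map_mul, map_mul, ← hc, pow_succ]
        nth_rewrite 2 [ht]
        rw [map_mul]
        field_simp
      · obtain ⟨a', s, hs, e⟩ := ha π hπ hd
        have hs0 := map_ne_zero_of_not_dvd ψ h.injective hs
        rw [map_mul] at e
        field_simp at e
        simp only [← map_mul] at e
        have e := h.injective e
        obtain ⟨a, rfl⟩ : π ∣ a := by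
          refine (hπ.dvd_or_dvd (b := s) (a := a) ?_).resolve_right hs
          exact ⟨a' * b, by linear_combination e⟩
        have e2 : ψ (π * a) / ψ (π * b) = ψ a / ψ b := by
          rw [map_mul, map_mul]; field_simp
        rw [e2] at ha ⊢
        exact ih hb a ha
  obtain ⟨a, b, hb, rfl⟩ := IsFractionRing.div_surjective (A := A) x
  rw [← h.map_hom a, ← h.map_hom b] at hx' ⊢
  obtain ⟨n, c, hc⟩ := key (h.hom b)
    ((map_ne_zero_iff _ h.hom_injective).2 (nonZeroDivisors.ne_zero hb)) _ hx'
  obtain ⟨m, a', ha'⟩ := h.exists_pow c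
  refine ⟨n + m, a', ?_⟩
  rw [← ha', ← hc, h.map_hom w]
  ring

end IsChart

end Charts

/-! ### Volume forms on affine three-space charts -/

section ChartForms

variable {K : Type*} [Field K] [Algebra ℂ K] (ψ : MvPolynomial (Fin 3) ℂ →ₐ[ℂ] K)

theorem D_map_mvPolynomial (b : MvPolynomial (Fin 3) ℂ) :
    KaehlerDifferential.D ℂ K (ψ b) = ∑ i, ψ (MvPolynomial.pderiv i b) •
      KaehlerDifferential.D ℂ K (ψ (MvPolynomial.X i)) := by
  induction b using MvPolynomial.induction_on with
  | C c =>
    have : ψ (MvPolynomial.C c) = algebraMap ℂ K c := ψ.commutes c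
    simp [this]
  | add p q hp hq => simp [hp, hq, add_smul, Finset.sum_add_distrib]
  | mul_X p j hp =>
    rw [map_mul, Derivation.leibniz, hp, Finset.smul_sum]
    have : ∀ i, ψ (MvPolynomial.pderiv i (p * MvPolynomial.X j)) •
        KaehlerDifferential.D ℂ K (ψ (MvPolynomial.X i)) =
        (if i = j then ψ p • KaehlerDifferential.D ℂ K (ψ (MvPolynomial.X j)) else 0) +
        ψ (MvPolynomial.X j) • ψ (MvPolynomial.pderiv i p) •
          KaehlerDifferential.D ℂ K (ψ (MvPolynomial.X i)) := by
      intro i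
      rw [Derivation.leibniz, MvPolynomial.pderiv_X]
      by_cases hij : i = j
      · subst hij
        simp [add_smul, mul_smul]
      · simp [hij, mul_smul]
    rw [Finset.sum_congr rfl fun i _ => this i, Finset.sum_add_distrib]
    simp

/-- The standard volume form of a chart. -/
def chartForm : ⋀[K]^3 (Ω[K⁄ℂ]) :=
  wedge₃ (KaehlerDifferential.D ℂ K (ψ (MvPolynomial.X 0)))
    (KaehlerDifferential.D ℂ K (ψ (MvPolynomial.X 1)))
    (KaehlerDifferential.D ℂ K (ψ (MvPolynomial.X 2)))

variable {ψ}

/-- By the chain and quotient rules, with unit denominators, every differential dv is a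
`V`-combination of the three coordinate differentials. -/
theorem regularForms_primeLocal (hψ : Function.Injective ψ) {π : MvPolynomial (Fin 3) ℂ}
    (hπ : Prime π) : regularForms (primeLocal ψ hψ hπ) 3 =
      Submodule.span (primeLocal ψ hψ hπ) {chartForm ψ} := by
  set V := primeLocal ψ hψ hπ
  refine le_antisymm (Submodule.span_le.2 ?_) ?_
  · rintro _ ⟨v, rfl⟩
    beta_reduce
    rw [wedge₃_eq]
    set S := Submodule.span V {KaehlerDifferential.D ℂ K (ψ (MvPolynomial.X 0)),
      KaehlerDifferential.D ℂ K (ψ (MvPolynomial.X 1)),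
      KaehlerDifferential.D ℂ K (ψ (MvPolynomial.X 2))} with hS
    have hsmul : ∀ (c : K), c ∈ V → ∀ y ∈ S, c • y ∈ S := fun c hc y hy =>
      S.smul_mem (⟨c, hc⟩ : V) hy
    have hX : ∀ i, KaehlerDifferential.D ℂ K (ψ (MvPolynomial.X i)) ∈ S := fun i =>
      Submodule.subset_span (by fin_cases i <;> simp)
    have hD : ∀ b, KaehlerDifferential.D ℂ K (ψ b) ∈ S := by
      intro b
      rw [D_map_mvPolynomial]
      exact sum_mem fun i _ => hsmul _ (map_mem_primeLocal hψ hπ _) _ (hX i)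
    have hV : ∀ x : V, KaehlerDifferential.D ℂ K (x : K) ∈ S := by
      rintro ⟨_, a, s, hs, rfl⟩
      obtain ⟨u, hu⟩ := exists_unit_primeLocal hψ hπ hs
      have hinv : (ψ s)⁻¹ ∈ V := by
        rw [← hu, ← coe_unit_inv]
        exact Subtype.property _
      rw [Derivation.leibniz_div]
      exact hsmul _ (pow_mem hinv 2) _ (sub_mem
        (hsmul _ (map_mem_primeLocal hψ hπ s) _ (hD a))
        (hsmul _ (map_mem_primeLocal hψ hπ a) _ (hD s)))
    exact wedge₃_mem_span (hV _) (hV _) (hV _)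
  · rw [Submodule.span_singleton_le_iff_mem]
    exact wedge₃_D_mem_regularForms (map_mem_primeLocal hψ hπ _) (map_mem_primeLocal hψ hπ _)
      (map_mem_primeLocal hψ hπ _)

/-- The coordinate differentials localize to a basis of the differentials of `K`, and the
determinant in that basis sends the form to 1. -/
theorem chartForm_ne_zero (hψ : Function.Injective ψ) (hfrac : ∀ x : K, ∃ a b, x = ψ a / ψ b) :
    chartForm ψ ≠ 0 := by
  let : Algebra (MvPolynomial (Fin 3) ℂ) K := ψ.toRingHom.toAlgebra
  have : IsScalarTower ℂ (MvPolynomial (Fin 3) ℂ) K :=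
    IsScalarTower.of_algebraMap_eq fun c => (ψ.commutes c).symm
  have : FaithfulSMul (MvPolynomial (Fin 3) ℂ) K := (faithfulSMul_iff_algebraMap_injective _ _).2 hψ
  have : IsFractionRing (MvPolynomial (Fin 3) ℂ) K :=
    IsFractionRing.of_field _ _ fun x => by
      obtain ⟨a, b, e⟩ := hfrac x
      exact ⟨a, b, e⟩
  let b := (KaehlerDifferential.mvPolynomialBasis ℂ (Fin 3)).ofIsLocalizedModule K
    (nonZeroDivisors (MvPolynomial (Fin 3) ℂ))
    (KaehlerDifferential.map ℂ ℂ (MvPolynomial (Fin 3) ℂ) K)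
  have hb : ∀ i, b i = KaehlerDifferential.D ℂ K (ψ (MvPolynomial.X i)) := by
    intro i
    rw [Module.Basis.ofIsLocalizedModule_apply, KaehlerDifferential.mvPolynomialBasis_apply,
      KaehlerDifferential.map_D]
    rfl
  intro h0
  have h1 := exteriorPower.alternatingMapLinearEquiv_apply_ιMulti b.det b
  rw [wedge₃_eq, hb, hb, hb] at h1
  change exteriorPower.alternatingMapLinearEquiv b.det (chartForm ψ) = _ at h1
  rw [h0, map_zero, b.det_self] at h1
  exact zero_ne_one h1

end ChartForms

/-! ### The singularity (1/4)(1,1,1) and its blowup charts -/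

section Veronese

open MvPolynomial

/-- The coordinate ring of the quotient singularity of type `(1/4)(1, 1, 1)`. -/
abbrev VeroneseRing : Subalgebra ℂ (MvPolynomial (Fin 3) ℂ) :=
  cyclicQuotientRing (n := 3) 4 fun _ => 1

/-- The function field of the quotient singularity of type `(1/4)(1, 1, 1)`. -/
abbrev VeroneseField : Type := FractionRing VeroneseRing

theorem coeff_cyclicAction (ξ : rootsOfUnity 4 ℂ) (p : MvPolynomial (Fin 3) ℂ) (α : Fin 3 →₀ ℕ) :
    coeff α (cyclicAction 4 (fun _ => 1) ξ p) =
      ((ξ : ℂˣ) : ℂ) ^ (∑ i, α i) * coeff α p := by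
  classical
  induction p using MvPolynomial.induction_on' with
  | monomial β c =>
    have : cyclicAction 4 (fun _ : Fin 3 => 1) ξ (monomial β c) =
        monomial β (((ξ : ℂˣ) : ℂ) ^ (∑ i, β i) * c) := by
      rw [cyclicAction, aeval_monomial, Finsupp.prod_fintype _ _ (by simp), monomial_eq (s := β),
        Finsupp.prod_fintype _ _ (by simp)]
      simp only [zpow_one, mul_pow, Finset.prod_mul_distrib, ← C_pow, ← map_prod,
        Finset.prod_pow_eq_pow_sum, algebraMap_eq, C_mul]
      ring
    rw [this, coeff_monomial, coeff_monomial]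
    split_ifs with h
    · rw [h]
    · simp
  | add p q hp hq => rw [map_add, coeff_add, hp, hq, coeff_add, mul_add]

theorem mem_veroneseRing {p : MvPolynomial (Fin 3) ℂ} :
    p ∈ VeroneseRing ↔ ∀ α, coeff α p ≠ 0 → 4 ∣ ∑ i, α i := by
  simp only [VeroneseRing, cyclicQuotientRing, Algebra.mem_iInf, AlgHom.mem_equalizer,
    AlgHom.coe_id, id_eq]
  constructor
  · intro h α hα
    have hI : IsPrimitiveRoot Complex.I 4 := by
      have := Complex.isPrimitiveRoot_exp 4 (by norm_num)
      convert this using 1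
      rw [show 2 * (Real.pi : ℂ) * Complex.I / (4 : ℕ) = Real.pi / 2 * Complex.I by
        push_cast; ring, Complex.exp_pi_div_two_mul_I]
    have hI0 : Complex.I ≠ 0 := Complex.I_ne_zero
    -- A primitive fourth root already detects divisibility of the degree by 4.
    let ξ : rootsOfUnity 4 ℂ := rootsOfUnity.mkOfPowEq Complex.I hI.pow_eq_one
    have h1 := congrArg (coeff α) (h ξ)
    rw [coeff_cyclicAction] at h1
    have h2 : Complex.I ^ (∑ i, α i) = 1 := by
      have h3 : Complex.I ^ (∑ i, α i) * coeff α p = 1 * coeff α p := by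
        rw [one_mul]; exact h1
      exact mul_right_cancel₀ hα h3
    exact hI.dvd_of_pow_eq_one _ h2
  · intro h ξ
    ext α
    rw [coeff_cyclicAction]
    by_cases hα : coeff α p = 0
    · simp [hα]
    · obtain ⟨d, hd⟩ := h α hα
      have hξ : ((ξ : ℂˣ) : ℂ) ^ 4 = 1 := by
        have := ξ.2
        rw [mem_rootsOfUnity'] at this
        exact this
      rw [hd, pow_mul, hξ, one_pow, one_mul]

theorem monomial_mem_veroneseRing {α : Fin 3 →₀ ℕ} (hα : 4 ∣ ∑ i, α i) (c : ℂ) :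
    monomial α c ∈ VeroneseRing := by
  classical
  rw [mem_veroneseRing]
  intro β hβ
  rw [coeff_monomial] at hβ
  by_cases h : α = β
  · rwa [← h]
  · simp [h] at hβ

theorem veroneseRing_induction {motive : VeroneseRing → Prop}
    (add : ∀ p q, motive p → motive q → motive (p + q))
    (mon : ∀ (α : Fin 3 →₀ ℕ) (hα : 4 ∣ ∑ i, α i) (c : ℂ),
      motive ⟨monomial α c, monomial_mem_veroneseRing hα c⟩)
    (p : VeroneseRing) : motive p := by
  have hp := mem_veroneseRing.1 p.2
  have : p = ∑ α ∈ p.1.support.attach, ⟨monomial α.1 (coeff α.1 p.1),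
      monomial_mem_veroneseRing (hp α.1 (mem_support_iff.1 α.2)) _⟩ := by
    ext1
    rw [AddSubmonoidClass.coe_finsetSum]
    rw [Finset.sum_attach p.1.support fun α => monomial α (coeff α p.1)]
    exact p.1.as_sum
  rw [this]
  refine Finset.sum_induction _ motive add ?_ fun α _ =>
    mon α.1 (hp α.1 (mem_support_iff.1 α.2)) _
  have := mon 0 (by simp) 0
  convert this
  simp

theorem mem_veroneseRing_of_mul_mem {a p : MvPolynomial (Fin 3) ℂ} (ha : a ∈ VeroneseRing)
    (ha0 : a ≠ 0) (h : a * p ∈ VeroneseRing) : p ∈ VeroneseRing := by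
  simp only [VeroneseRing, cyclicQuotientRing, Algebra.mem_iInf, AlgHom.mem_equalizer,
    AlgHom.coe_id, id_eq] at *
  intro ξ
  have h1 := h ξ
  rw [map_mul, ha ξ] at h1
  exact mul_left_cancel₀ ha0 h1

theorem X_mul_X_pow_mem (i c : Fin 3) :
    (X i * X c ^ 3 : MvPolynomial (Fin 3) ℂ) ∈ VeroneseRing := by
  have : (X i * X c ^ 3 : MvPolynomial (Fin 3) ℂ) =
      monomial (Finsupp.single i 1 + Finsupp.single c 3) 1 := by
    rw [X_pow_eq_monomial, X, monomial_mul, one_mul]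
  rw [this]
  refine monomial_mem_veroneseRing ?_ 1
  simp [Finset.sum_add_distrib, Finsupp.single_apply]

theorem X_pow_mem (c : Fin 3) : (X c ^ 4 : MvPolynomial (Fin 3) ℂ) ∈ VeroneseRing := by
  have := X_mul_X_pow_mem c c
  rwa [← pow_succ'] at this

/-- The invariant `x_c ^ 4`. -/
def veronesePow (c : Fin 3) : VeroneseRing := ⟨X c ^ 4, X_pow_mem c⟩

/-- The invariant `x_i * x_c ^ 3`. -/
def veroneseMix (i c : Fin 3) : VeroneseRing := ⟨X i * X c ^ 3, X_mul_X_pow_mem i c⟩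

theorem veronesePow_ne_zero (c : Fin 3) : veronesePow c ≠ 0 := by
  intro h
  have := congrArg Subtype.val h
  exact pow_ne_zero 4 (X_ne_zero c) this

/-- The function `x_c ^ 4` in the function field. -/
def powFun (c : Fin 3) : VeroneseField := algebraMap VeroneseRing _ (veronesePow c)

theorem powFun_ne_zero (c : Fin 3) : powFun c ≠ 0 :=
  (map_ne_zero_iff _ (IsFractionRing.injective VeroneseRing VeroneseField)).2
    (veronesePow_ne_zero c)

/-- The chart with coordinates `x_c ^ 4` and `x_i / x_c` for `i ≠ c`. -/
def veroneseChart (c : Fin 3) : MvPolynomial (Fin 3) ℂ →ₐ[ℂ] VeroneseField :=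
  aeval fun i => if i = c then powFun c else algebraMap VeroneseRing _ (veroneseMix i c) / powFun c

theorem veroneseChart_X (c i : Fin 3) : veroneseChart c (X i) =
    if i = c then powFun c else algebraMap VeroneseRing _ (veroneseMix i c) / powFun c := by
  rw [veroneseChart, aeval_X]

/-- The embedding of the function field into that of affine space. -/
def veroneseEmb : VeroneseField →+* FractionRing (MvPolynomial (Fin 3) ℂ) :=
  IsFractionRing.lift (A := VeroneseRing)
    (g := (algebraMap (MvPolynomial (Fin 3) ℂ) (FractionRing (MvPolynomial (Fin 3) ℂ))).comp
      VeroneseRing.val.toRingHom)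
    ((IsFractionRing.injective (MvPolynomial (Fin 3) ℂ)
      (FractionRing (MvPolynomial (Fin 3) ℂ))).comp Subtype.val_injective)

theorem veroneseEmb_algebraMap (a : VeroneseRing) :
    veroneseEmb (algebraMap _ _ a) = algebraMap (MvPolynomial (Fin 3) ℂ) _ a.1 :=
  IsFractionRing.lift_algebraMap _ _

theorem veroneseEmb_chart_X (c i : Fin 3) :
    veroneseEmb (veroneseChart c (X i)) =
      if i = c then algebraMap (MvPolynomial (Fin 3) ℂ) _ (X c) ^ 4
      else algebraMap (MvPolynomial (Fin 3) ℂ) _ (X i) /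
        algebraMap (MvPolynomial (Fin 3) ℂ) _ (X c) := by
  have hX : algebraMap (MvPolynomial (Fin 3) ℂ) (FractionRing (MvPolynomial (Fin 3) ℂ)) (X c) ≠ 0 :=
    (map_ne_zero_iff _ (IsFractionRing.injective _ _)).2 (X_ne_zero c)
  rw [veroneseChart_X]
  split_ifs
  · rw [powFun, veroneseEmb_algebraMap, veronesePow, map_pow]
  · rw [powFun, map_div₀, veroneseEmb_algebraMap, veroneseEmb_algebraMap, veronesePow, veroneseMix]
    simp only [map_mul, map_pow]
    field_simp

/-- Monomials on the chart. -/
theorem veroneseChart_monomial (c : Fin 3) {α : Fin 3 →₀ ℕ} {d : ℕ} (hd : ∑ i, α i = 4 * d)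
    (k : ℂ) :
    -- In degree 4d, x^α is (x_c⁴)^d times the product of (x_i/x_c)^(αᵢ) over i ≠ c.
    veroneseChart c (C k * ∏ i, X i ^ (if i = c then d else α i)) =
      algebraMap VeroneseRing _
        ⟨monomial α k, monomial_mem_veroneseRing (hd ▸ dvd_mul_right 4 d) k⟩ := by
  apply veroneseEmb.injective
  have hX : ∀ i, algebraMap (MvPolynomial (Fin 3) ℂ) (FractionRing (MvPolynomial (Fin 3) ℂ)) (X i)
      ≠ 0 := fun i => (map_ne_zero_iff _ (IsFractionRing.injective _ _)).2 (X_ne_zero i)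
  have hC : veroneseEmb (veroneseChart c (C k)) =
      algebraMap (MvPolynomial (Fin 3) ℂ) _ (C k) := by
    have h1 : veroneseChart c (C k) =
        algebraMap VeroneseRing VeroneseField (algebraMap ℂ VeroneseRing k) := by
      rw [← IsScalarTower.algebraMap_apply]
      exact (veroneseChart c).commutes k
    rw [h1, veroneseEmb_algebraMap]
    rfl
  rw [veroneseEmb_algebraMap]
  change _ = algebraMap (MvPolynomial (Fin 3) ℂ) _ (monomial α k)
  rw [monomial_eq, Finsupp.prod_fintype _ _ (by simp)]
  simp only [map_mul, map_prod, map_pow, veroneseEmb_chart_X, hC]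
  congr 1
  rw [Fin.sum_univ_three] at hd
  have h0 := hX 0
  have h1 := hX 1
  have h2 := hX 2
  simp only [Fin.prod_univ_three]
  fin_cases c <;> simp [div_pow, ← pow_mul, ← hd, pow_add] <;> field_simp

/-- The first clause clears denominators as `IsChart` requires; the evaluation clause serves to
prove the chart map injective. -/
theorem exists_pow_mul_veroneseChart (c : Fin 3) (b : MvPolynomial (Fin 3) ℂ) :
    ∃ (n : ℕ) (a : VeroneseRing), powFun c ^ n * veroneseChart c b = algebraMap _ _ a ∧
      ∀ s : Fin 3 → ℂ, s c ≠ 0 → eval s a.1 = s c ^ (4 * n) *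
        eval (fun i => if i = c then s c ^ 4 else s i / s c) b := by
  induction b using MvPolynomial.induction_on with
  | C k =>
    refine ⟨0, algebraMap ℂ VeroneseRing k, ?_, ?_⟩
    · rw [pow_zero, one_mul, ← IsScalarTower.algebraMap_apply]
      exact (veroneseChart c).commutes k
    · intro s _
      have : ((algebraMap ℂ VeroneseRing k : VeroneseRing) : MvPolynomial (Fin 3) ℂ) = C k := rfl
      simp [this]
  | add p q hp hq =>
    obtain ⟨n, a, ha, ha'⟩ := hp
    obtain ⟨m, b, hb, hb'⟩ := hq
    refine ⟨n + m, veronesePow c ^ m * a + veronesePow c ^ n * b, ?_, ?_⟩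
    · simp only [map_add, map_mul, map_pow, ← ha, ← hb]
      rw [← powFun]
      ring
    · intro s hs
      have : ((veronesePow c : VeroneseRing) : MvPolynomial (Fin 3) ℂ) = X c ^ 4 := rfl
      push_cast
      rw [this]
      simp only [map_add, map_mul, map_pow, eval_X, ha' s hs, hb' s hs]
      ring
  | mul_X p i hp =>
    obtain ⟨n, a, ha, ha'⟩ := hp
    have hw := powFun_ne_zero c
    by_cases hi : i = c
    · refine ⟨n, a * veronesePow c, ?_, ?_⟩
      · rw [map_mul, map_mul, ← ha, veroneseChart_X, if_pos hi, ← powFun]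
        ring
      · intro s hs
        have : ((veronesePow c : VeroneseRing) : MvPolynomial (Fin 3) ℂ) = X c ^ 4 := rfl
        push_cast
        rw [this]
        simp only [map_mul, map_pow, eval_X, ha' s hs, if_pos hi]
        ring
    · refine ⟨n + 1, a * veroneseMix i c, ?_, ?_⟩
      · rw [map_mul, map_mul, ← ha, veroneseChart_X, if_neg hi]
        field_simp
        ring
      · intro s hs
        have : ((veroneseMix i c : VeroneseRing) : MvPolynomial (Fin 3) ℂ) = X i * X c ^ 3 := rfl
        push_cast
        rw [this]
        simp only [map_mul, map_pow, eval_X, ha' s hs, if_neg hi]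
        field_simp
        ring

theorem veroneseChart_injective (c : Fin 3) : Function.Injective (veroneseChart c) := by
  rw [injective_iff_map_eq_zero]
  intro b hb
  obtain ⟨n, a, ha, ha'⟩ := exists_pow_mul_veroneseChart c b
  rw [hb, mul_zero, eq_comm, map_eq_zero_iff _ (IsFractionRing.injective _ _)] at ha
  subst ha
  -- A point with t c ≠ 0 is reached from s by taking a fourth root of t c. The factor X c takes
  -- care of the hyperplane t c = 0.
  have : X c * b = 0 := by
    apply MvPolynomial.funext
    intro t
    rw [map_mul, eval_X, map_zero]
    by_cases ht : t c = 0
    · simp [ht]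
    obtain ⟨z, hz⟩ := IsAlgClosed.exists_pow_nat_eq (t c) (n := 4) (by norm_num)
    have hz0 : z ≠ 0 := by
      rintro rfl
      exact ht (by rw [← hz]; norm_num)
    have h := ha' (fun i => if i = c then z else t i * z) (by simpa using hz0)
    have ht' : (fun i => if i = c then (if c = c then z else t c * z) ^ 4
        else (if i = c then z else t i * z) / (if c = c then z else t c * z)) = t := by
      ext i
      by_cases hi : i = c
      · simp [hi, hz]
      · simp [hi, hz0]
    rw [ht'] at h
    simp only [ZeroMemClass.coe_zero, map_zero, if_true] at h
    rw [(mul_eq_zero.1 h.symm).resolve_left (pow_ne_zero _ hz0), mul_zero]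
  exact (mul_eq_zero.1 this).resolve_left (X_ne_zero c)

theorem isChart_veroneseChart (c : Fin 3) : IsChart (veroneseChart c) (veronesePow c) where
  injective := veroneseChart_injective c
  exists_eq := by
    refine veroneseRing_induction ?_ ?_
    · rintro p q ⟨a, ha⟩ ⟨b, hb⟩
      exact ⟨a + b, by rw [map_add, map_add, ha, hb]⟩
    · rintro α ⟨d, hd⟩ k
      exact ⟨_, veroneseChart_monomial c hd k⟩
  exists_pow b := by
    obtain ⟨n, a, ha, _⟩ := exists_pow_mul_veroneseChart c b
    exact ⟨n, a, ha⟩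
  ne_zero := veronesePow_ne_zero c

theorem veroneseChart_X_self (c : Fin 3) : veroneseChart c (X c) = powFun c := by
  rw [veroneseChart_X, if_pos rfl]

theorem hom_veronesePow (c : Fin 3) : (isChart_veroneseChart c).hom (veronesePow c) = X c := by
  apply veroneseChart_injective c
  rw [IsChart.map_hom, veroneseChart_X_self, powFun]

theorem powFun_eq {c i : Fin 3} (hi : i ≠ c) :
    powFun i = veroneseChart c (X c) * veroneseChart c (X i) ^ 4 := by
  apply veroneseEmb.injective
  rw [map_mul, map_pow, veroneseEmb_chart_X, veroneseEmb_chart_X, if_pos rfl, if_neg hi, powFun,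
    veroneseEmb_algebraMap, veronesePow, map_pow]
  have hX : algebraMap (MvPolynomial (Fin 3) ℂ) (FractionRing (MvPolynomial (Fin 3) ℂ)) (X c) ≠ 0 :=
    (map_ne_zero_iff _ (IsFractionRing.injective _ _)).2 (X_ne_zero c)
  field_simp

end Veronese

/-! ### The lower bound for log discrepancies -/

section LogDiscrepancyBound

variable {K : Type*} [Field K] [Algebra ℂ K]

theorem D_mul_pow_four (x y : K) :
    KaehlerDifferential.D ℂ K (x * y ^ 4) =
      y ^ 4 • KaehlerDifferential.D ℂ K x + (4 * x * y ^ 3) • KaehlerDifferential.D ℂ K y := by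
  rw [Derivation.leibniz, Derivation.leibniz_pow, ← Nat.cast_smul_eq_nsmul K, smul_smul, smul_smul,
    add_comm]
  congr 2
  push_cast
  ring

/-- Since dlog(x y⁴) = dlog x + 4 dlog y, the wedge is 4 · 4 times that of dlog x, dlog y, dlog z.
-/
theorem logForm_left {x y z : K} (hx : x ≠ 0) (hy : y ≠ 0) (hz : z ≠ 0) :
    (x * (x * y ^ 4) * (x * z ^ 4))⁻¹ • wedge₃ (K := K) (KaehlerDifferential.D ℂ K x)
      (KaehlerDifferential.D ℂ K (x * y ^ 4)) (KaehlerDifferential.D ℂ K (x * z ^ 4)) =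
    (16 * (x * y * z)⁻¹) • wedge₃ (K := K) (KaehlerDifferential.D ℂ K x)
      (KaehlerDifferential.D ℂ K y) (KaehlerDifferential.D ℂ K z) := by
  rw [D_mul_pow_four, D_mul_pow_four]
  simp only [wedge₃_add_mid, wedge₃_add_right, wedge₃_smul_mid, wedge₃_smul_right,
    wedge₃_self_left, wedge₃_self_outer, smul_zero, zero_add, smul_smul]
  congr 1
  field_simp
  norm_num

theorem logForm_mid {x y z : K} (hx : x ≠ 0) (hy : y ≠ 0) (hz : z ≠ 0) :
    (y * x ^ 4 * y * (y * z ^ 4))⁻¹ • wedge₃ (K := K) (KaehlerDifferential.D ℂ K (y * x ^ 4))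
      (KaehlerDifferential.D ℂ K y) (KaehlerDifferential.D ℂ K (y * z ^ 4)) =
    (16 * (x * y * z)⁻¹) • wedge₃ (K := K) (KaehlerDifferential.D ℂ K x)
      (KaehlerDifferential.D ℂ K y) (KaehlerDifferential.D ℂ K z) := by
  have h := logForm_left hy hx hz
  rw [wedge₃_swap_left (K := K), smul_neg, wedge₃_swap_left (K := K) (KaehlerDifferential.D ℂ K x), smul_neg,
    neg_inj] at h
  convert h using 2 <;> ring

theorem logForm_right {x y z : K} (hx : x ≠ 0) (hy : y ≠ 0) (hz : z ≠ 0) :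
    (z * x ^ 4 * (z * y ^ 4) * z)⁻¹ • wedge₃ (K := K) (KaehlerDifferential.D ℂ K (z * x ^ 4))
      (KaehlerDifferential.D ℂ K (z * y ^ 4)) (KaehlerDifferential.D ℂ K z) =
    (16 * (x * y * z)⁻¹) • wedge₃ (K := K) (KaehlerDifferential.D ℂ K x)
      (KaehlerDifferential.D ℂ K y) (KaehlerDifferential.D ℂ K z) := by
  have h := logForm_mid hx hz hy
  rw [wedge₃_swap_right (K := K), smul_neg, wedge₃_swap_right (K := K) _ (KaehlerDifferential.D ℂ K y), smul_neg,
    neg_inj] at h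
  convert h using 2 <;> ring

theorem logForm_chart {F G : Fin 3 → K} {c : Fin 3} (h : ∀ i, G i ≠ 0) (hc : F c = G c)
    (hne : ∀ i, i ≠ c → F i = G c * G i ^ 4) :
    (F 0 * F 1 * F 2)⁻¹ • wedge₃ (K := K) (KaehlerDifferential.D ℂ K (F 0))
      (KaehlerDifferential.D ℂ K (F 1)) (KaehlerDifferential.D ℂ K (F 2)) =
    (16 * (G 0 * G 1 * G 2)⁻¹) • wedge₃ (K := K) (KaehlerDifferential.D ℂ K (G 0))
      (KaehlerDifferential.D ℂ K (G 1)) (KaehlerDifferential.D ℂ K (G 2)) := by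
  fin_cases c <;> simp only [Fin.zero_eta, Fin.mk_one, Fin.reduceFinMk] at hc hne
  · rw [hc, hne 1 (by decide), hne 2 (by decide)]
    exact logForm_left (h 0) (h 1) (h 2)
  · rw [hc, hne 0 (by decide), hne 2 (by decide)]
    exact logForm_mid (h 0) (h 1) (h 2)
  · rw [hc, hne 0 (by decide), hne 1 (by decide)]
    exact logForm_right (h 0) (h 1) (h 2)

theorem hasOrd_algebraMap (V : Subalgebra ℂ K) (ϖ : K) {z : ℂ} (hz : z ≠ 0) :
    HasOrd V ϖ (algebraMap ℂ K z) 0 := by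
  refine .of_unit (exists_unit_of_mem ((map_ne_zero _).2 hz) (V.algebraMap_mem z) ?_)
  rw [← map_inv₀]
  exact V.algebraMap_mem _

theorem hasOrd_sixteen (V : Subalgebra ℂ K) (ϖ : K) : HasOrd V ϖ 16 0 := by
  have h := hasOrd_algebraMap V ϖ (z := 16) (by norm_num)
  rwa [map_ofNat] at h

theorem sixteen_ne_zero : (16 : K) ≠ 0 := by
  have : CharZero K := charZero_of_injective_algebraMap (algebraMap ℂ K).injective
  norm_num

/-- The extra factor G c is a unit off the exceptional divisor, where orders therefore agree up to
the factor 4. Along that divisor it shifts the order from -4 to -3. -/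
theorem logFormFun_chart {F G : Fin 3 → K} {c : Fin 3} (h : ∀ i, G i ≠ 0) (hc : F c = G c)
    (hne : ∀ i, i ≠ c → F i = G c * G i ^ 4) :
    (F 0 * F 1 * F 2)⁻¹ = (16 * (G 0 * G 1 * G 2)⁻¹) ^ 4 * (16 ^ 4)⁻¹ * G c := by
  have h16 : (16 : K) ≠ 0 := sixteen_ne_zero
  have h0 := h 0
  have h1 := h 1
  have h2 := h 2
  fin_cases c <;> simp only [Fin.zero_eta, Fin.mk_one, Fin.reduceFinMk] at hc hne ⊢
  · rw [hc, hne 1 (by decide), hne 2 (by decide)]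
    field_simp
  · rw [hc, hne 0 (by decide), hne 2 (by decide)]
    field_simp
  · rw [hc, hne 0 (by decide), hne 1 (by decide)]
    field_simp

/-- A lower bound for log discrepancies at points where three functions vanish, if four times the
logarithmic volume form of these functions has the divisor of the inverse of their product. -/
theorem three_quarters_le_of_hasLogDiscrepancy {A : Type*} [CommRing A] [IsDomain A] [Algebra ℂ A]
    {f : Fin 3 → FractionRing A} (hf0 : ∀ c, f c ≠ 0) {η : ⋀[FractionRing A]^3 (Ω[FractionRing A⁄ℂ])}
    (hη : η = (f 0 * f 1 * f 2)⁻¹ • wedge₃ (K := FractionRing A) (KaehlerDifferential.D ℂ (FractionRing A) (f 0))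
      (KaehlerDifferential.D ℂ (FractionRing A) (f 1))
      (KaehlerDifferential.D ℂ (FractionRing A) (f 2))) (hη0 : η ≠ 0)
    (hdvr : ∀ (P : Ideal A) [P.IsPrime], P.height = 1 → IsDiscreteValuationRing (localRingAt A P))
    (hord : ∀ (P : Ideal A) [P.IsPrime], P.height = 1 → ∃ k : ℤ,
      HasFormOrder (localRingAt A P) η k ∧
      HasFunctionOrder (localRingAt A P) (f 0 * f 1 * f 2)⁻¹ ((4 : ℕ) * k))
    (hreg : ∀ {x : FractionRing A}, (∀ (P : Ideal A) [P.IsPrime], P.height = 1 →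
      x ∈ localRingAt A P) → ∃ a : A, x = algebraMap _ _ a)
    {V : Subalgebra ℂ (FractionRing A)} (hV : IsDivisorOver A V) (hF : ∀ c, f c ∈ V)
    (hnu : ∀ c, ¬ ∃ u : Vˣ, ((u : V) : FractionRing A) = f c)
    {a : ℝ} (ha : HasLogDiscrepancy A 3 V a) : 3 / 4 ≤ a := by
  obtain ⟨ω, m, g, hω, hm, hg, hP, i, j, hi, hj, rfl⟩ := ha
  have := hV.isDiscreteValuationRing
  have := hV.isFractionRing
  obtain ⟨ϖ, hϖ⟩ := IsDiscreteValuationRing.exists_irreducible V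
  have hϖ0 : (ϖ : FractionRing A) ≠ 0 := by simpa using hϖ.ne_zero
  have hFord : ∀ c, ∃ n : ℤ, 1 ≤ n ∧ HasOrd V (ϖ : FractionRing A) (f c) n := by
    intro c
    obtain ⟨n, hn⟩ := exists_hasOrd hϖ (hf0 c)
    refine ⟨n, ?_, hn⟩
    have h0 := (hasOrd_mem_iff hϖ hn).1 (hF c)
    rcases h0.eq_or_lt with rfl | h0
    · exact absurd hn.exists_unit (hnu c)
    · omega
  choose n hn1 hn using hFord
  -- Here H + i is the order of η along `V`; the inequality says that the pole is at most simple.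
  obtain ⟨h, H, hlog, hH, hHi⟩ : ∃ (h : FractionRing A) (H : ℤ), η = h • ω ∧
      HasOrd V (ϖ : FractionRing A) h H ∧ 0 ≤ H + (i + 1) := by
    have hmem := smul_logForm_mem_regularForms hϖ hF hf0
    rw [← hi.span_eq hϖ, Submodule.mem_span_singleton, mul_smul] at hmem
    obtain ⟨v, hv⟩ := hmem
    have hv : v • (ϖ : FractionRing A) ^ (-i) • ω = (ϖ : FractionRing A) • η := by
      rw [hv, hη]
    have hlog : η = ((v : FractionRing A) * (ϖ : FractionRing A) ^ (-(i + 1))) • ω := by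
      have h1 : η = (ϖ : FractionRing A)⁻¹ • (ϖ : FractionRing A) • η := by
        rw [smul_smul, inv_mul_cancel₀ hϖ0, one_smul]
      rw [h1, ← hv, Subalgebra.smul_def, smul_smul, smul_smul]
      congr 1
      rw [neg_add, zpow_add₀ hϖ0, zpow_neg_one]
      ring
    have hh0 : (v : FractionRing A) * (ϖ : FractionRing A) ^ (-(i + 1)) ≠ 0 := by
      intro h0
      rw [h0, zero_smul] at hlog
      exact hη0 hlog
    obtain ⟨H, hH⟩ := exists_hasOrd hϖ hh0
    refine ⟨_, H, hlog, hH, ?_⟩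
    have h2 := hH.mul hϖ0 (HasOrd.self.zpow (i + 1))
    rw [mul_one, mul_assoc, ← zpow_add₀ hϖ0, neg_add_cancel, zpow_zero, mul_one] at h2
    exact (hasOrd_mem_iff hϖ h2).1 v.2
  -- Compares the given data (ω, m, g) with (η, 4, (f₀f₁f₂)⁻¹): both compute the canonical divisor,
  -- so this quotient has order zero in codimension one. By `hreg` it and its inverse are regular,
  -- hence units in `V`.
  have hunit : ∀ (P : Ideal A) [P.IsPrime], P.height = 1 →
      ∃ u : (localRingAt A P)ˣ, ((u : localRingAt A P) : FractionRing A) =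
        g ^ 4 * h ^ (4 * m) * ((f 0 * f 1 * f 2)⁻¹ ^ m)⁻¹ := by
    intro P _ hP1
    have := hdvr P hP1
    obtain ⟨t, ht⟩ := IsDiscreteValuationRing.exists_irreducible (localRingAt A P)
    have ht0 : (t : FractionRing A) ≠ 0 := by simpa using ht.ne_zero
    obtain ⟨k, hk, hgk⟩ := hP P hP1
    obtain ⟨l, hl, hfl⟩ := hord P hP1
    rw [hlog] at hl
    rw [hasFunctionOrder_iff ht] at hgk hfl
    have hh := hk.hasOrd_sub hω hl ht
    have := ((hgk.pow 4).mul ht0 (hh.pow (4 * m))).mul ht0 (hfl.pow m).inv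
    refine HasOrd.exists_unit (ϖ := (t : FractionRing A)) ?_
    convert this using 1
    push_cast
    ring
  have hG : HasOrd V (ϖ : FractionRing A) (g ^ 4 * h ^ (4 * m) * ((f 0 * f 1 * f 2)⁻¹ ^ m)⁻¹) 0 := by
    obtain ⟨x, hx⟩ := hreg
      (x := g ^ 4 * h ^ (4 * m) * ((f 0 * f 1 * f 2)⁻¹ ^ m)⁻¹) (by
        intro P _ hP1
        obtain ⟨u, hu⟩ := hunit P hP1
        rw [← hu]
        exact Subtype.property _)
    obtain ⟨y, hy⟩ := hreg
      (x := (g ^ 4 * h ^ (4 * m) * ((f 0 * f 1 * f 2)⁻¹ ^ m)⁻¹)⁻¹) (by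
        intro P _ hP1
        obtain ⟨u, hu⟩ := hunit P hP1
        rw [← hu, ← coe_unit_inv]
        exact Subtype.property _)
    refine .of_unit (exists_unit_of_mem ?_ (hx ▸ hV.algebraMap_mem x) (hy ▸ hV.algebraMap_mem y))
    have hh0 := hH.ne_zero hϖ0
    have hf0 : (f 0 * f 1 * f 2)⁻¹ ≠ 0 := inv_ne_zero
      (mul_ne_zero (mul_ne_zero (hf0 0) (hf0 1)) (hf0 2))
    exact mul_ne_zero (mul_ne_zero (pow_ne_zero _ hg) (pow_ne_zero _ hh0))
      (inv_ne_zero (pow_ne_zero _ hf0))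
  rw [hasFunctionOrder_iff hϖ] at hj
  have hfun : HasOrd V (ϖ : FractionRing A) (f 0 * f 1 * f 2)⁻¹ (-(n 0 + n 1 + n 2)) :=
    (((hn 0).mul hϖ0 (hn 1)).mul hϖ0 (hn 2)).inv
  have hord := hG.unique hϖ
    (((hj.pow 4).mul hϖ0 (hH.pow (4 * m))).mul hϖ0 (hfun.pow m).inv)
  have hordR : (0 : ℝ) = 4 * j + 4 * m * H + m * (n 0 + n 1 + n 2) := by
    have : (0 : ℤ) = 4 * j + 4 * m * H + m * (n 0 + n 1 + n 2) := by
      rw [hord]; push_cast; ring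
    exact_mod_cast this
  have hm0 : (0 : ℝ) < m := by exact_mod_cast hm
  have hjm : (j : ℝ) / m = -H - (n 0 + n 1 + n 2) / 4 := by
    field_simp
    linarith
  rw [hjm]
  have b0 : (1 : ℝ) ≤ n 0 := by exact_mod_cast hn1 0
  have b1 : (1 : ℝ) ≤ n 1 := by exact_mod_cast hn1 1
  have b2 : (1 : ℝ) ≤ n 2 := by exact_mod_cast hn1 2
  have b3 : (0 : ℝ) ≤ H + (i + 1) := by exact_mod_cast hHi
  linarith

end LogDiscrepancyBound

/-! ### The minimal log discrepancy of (1/4)(1,1,1) -/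

section VeroneseMld

open MvPolynomial

/-- If all three fourth powers lay in `P`, the contraction of (X 0) would be a prime strictly
between 0 and `P`. Thus the charts cover codimension one. -/
theorem exists_veronesePow_not_mem {P : Ideal VeroneseRing} [P.IsPrime] (hP : P.height = 1) :
    ∃ c, veronesePow c ∉ P := by
  by_contra! h
  have hX : Prime (X 0 : MvPolynomial (Fin 3) ℂ) := X_prime
  let Q : Ideal VeroneseRing :=
    (Ideal.span {(X 0 : MvPolynomial (Fin 3) ℂ)}).comap VeroneseRing.val.toRingHom
  have hmem : ∀ a : VeroneseRing, a ∈ Q ↔ X 0 ∣ a.1 := fun a => by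
    rw [Ideal.mem_comap, Ideal.mem_span_singleton]; rfl
  have hQ : Q.IsPrime := by
    have := (Ideal.span_singleton_prime hX.ne_zero).2 hX
    exact Ideal.comap_isPrime _ _
  have hQP : Q ≤ P := by
    intro a ha
    obtain ⟨b, hb⟩ := (hmem a).1 ha
    -- The cofactor b need not be invariant, but b⁴ is, since X 0 ^ 4 * b⁴ is.
    have e : (a ^ 4).1 = X 0 ^ 4 * b ^ 4 := by
      push_cast
      rw [hb, mul_pow]
    have hb4 : b ^ 4 ∈ VeroneseRing := mem_veroneseRing_of_mul_mem (X_pow_mem 0)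
      (pow_ne_zero 4 (X_ne_zero 0)) (e ▸ (a ^ 4).2)
    have : a ^ 4 = veronesePow 0 * ⟨b ^ 4, hb4⟩ := Subtype.ext e
    exact Ideal.IsPrime.mem_of_pow_mem ‹_› 4 (this ▸ P.mul_mem_right _ (h 0))
  have h0 : veronesePow 0 ∈ Q := (hmem _).2 (dvd_pow_self _ (by norm_num))
  have h1 : veronesePow 1 ∉ Q := by
    rw [hmem]
    intro hd
    have := hX.dvd_of_dvd_pow (hd : (X 0 : MvPolynomial (Fin 3) ℂ) ∣ X 1 ^ 4)
    rw [X_dvd_X] at this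
    simp at this
  have hlt : Q < P := lt_of_le_of_ne hQP fun e => h1 (e ▸ h 1)
  have h2 := Ideal.height_le_iff.1 (show P.height ≤ (1 : ℕ) by simp [hP]) _ hQ hlt
  have h3 : Q.height = 0 := by simpa [Order.lt_one_iff] using h2
  rw [Ideal.height_eq_zero_iff_eq_bot] at h3
  rw [h3, Ideal.mem_bot] at h0
  exact veronesePow_ne_zero 0 h0

/-- Functions without poles in codimension one are regular. -/
theorem exists_eq_algebraMap_of_mem_localRingAt {x : VeroneseField}
    (hx : ∀ (P : Ideal VeroneseRing) [P.IsPrime], P.height = 1 → x ∈ localRingAt VeroneseRing P) :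
    ∃ a : VeroneseRing, x = algebraMap _ _ a := by
  obtain ⟨n, p, hp⟩ := (isChart_veroneseChart 0).exists_pow_mul_eq hx
  obtain ⟨m, q, hq⟩ := (isChart_veroneseChart 1).exists_pow_mul_eq hx
  have hinj := IsFractionRing.injective VeroneseRing VeroneseField
  have e : p * veronesePow 1 ^ m = veronesePow 0 ^ n * q := by
    apply hinj
    simp only [map_mul, map_pow, ← hp, ← hq]
    ring
  have e' : p.1 * (X 1 ^ 4) ^ m = (X 0 ^ 4) ^ n * q.1 := congrArg Subtype.val e
  have hX : Prime (X 0 : MvPolynomial (Fin 3) ℂ) := X_prime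
  -- Two charts suffice: the denominators are powers of the coprime X 0 and X 1.
  obtain ⟨a, ha⟩ : X 0 ^ (4 * n) ∣ p.1 := by
    refine hX.pow_dvd_of_dvd_mul_right (4 * n) (b := (X 1 ^ 4) ^ m) ?_ ?_
    · intro hd
      have := hX.dvd_of_dvd_pow (hX.dvd_of_dvd_pow hd)
      rw [X_dvd_X] at this
      simp at this
    · rw [e', pow_mul]
      exact dvd_mul_right _ _
  rw [pow_mul] at ha
  have haV : a ∈ VeroneseRing := mem_veroneseRing_of_mul_mem (pow_mem (X_pow_mem 0) n)
    (pow_ne_zero n (pow_ne_zero 4 (X_ne_zero 0))) (ha ▸ p.2)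
  refine ⟨⟨a, haV⟩, ?_⟩
  have hpa : p = veronesePow 0 ^ n * ⟨a, haV⟩ := Subtype.ext ha
  rw [hpa, map_mul, map_pow] at hp
  exact mul_left_cancel₀ (pow_ne_zero n (powFun_ne_zero 0)) hp

/-- The invariant logarithmic volume form. -/
def logForm : ⋀[VeroneseField]^3 (Ω[VeroneseField⁄ℂ]) :=
  (powFun 0 * powFun 1 * powFun 2)⁻¹ • wedge₃ (KaehlerDifferential.D ℂ VeroneseField (powFun 0))
    (KaehlerDifferential.D ℂ VeroneseField (powFun 1))
    (KaehlerDifferential.D ℂ VeroneseField (powFun 2))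

/-- The function whose divisor is four times the divisor of `logForm`. -/
def logFormFun : VeroneseField := (powFun 0 * powFun 1 * powFun 2)⁻¹

/-- The coefficient of `logForm` with respect to the volume form of a chart. -/
def logFormCoeff (c : Fin 3) : VeroneseField :=
  16 * (veroneseChart c (X 0) * veroneseChart c (X 1) * veroneseChart c (X 2))⁻¹

theorem veroneseChart_X_ne_zero (c i : Fin 3) : veroneseChart c (X i) ≠ 0 :=
  (map_ne_zero_iff _ (veroneseChart_injective c)).2 (X_ne_zero i)

theorem logFormCoeff_ne_zero (c : Fin 3) : logFormCoeff c ≠ 0 := by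
  have h := veroneseChart_X_ne_zero c
  exact mul_ne_zero sixteen_ne_zero (inv_ne_zero (mul_ne_zero (mul_ne_zero (h 0) (h 1)) (h 2)))

theorem logForm_eq (c : Fin 3) : logForm = logFormCoeff c • chartForm (veroneseChart c) :=
  logForm_chart (F := powFun) (G := fun i => veroneseChart c (X i)) (veroneseChart_X_ne_zero c) (veroneseChart_X_self c).symm
    fun _ hi => powFun_eq hi

theorem logFormFun_eq (c : Fin 3) :
    logFormFun = logFormCoeff c ^ 4 * (16 ^ 4)⁻¹ * veroneseChart c (X c) :=
  logFormFun_chart (F := powFun) (G := fun i => veroneseChart c (X i)) (veroneseChart_X_ne_zero c) (veroneseChart_X_self c).symm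
    fun _ hi => powFun_eq hi

theorem chartForm_veroneseChart_ne_zero (c : Fin 3) : chartForm (veroneseChart c) ≠ 0 :=
  chartForm_ne_zero (veroneseChart_injective c) (isChart_veroneseChart c).exists_div

theorem logForm_ne_zero : logForm ≠ 0 := by
  rw [logForm_eq 0]
  exact smul_ne_zero (logFormCoeff_ne_zero 0) (chartForm_veroneseChart_ne_zero 0)

theorem hasFormOrder_logForm_primeLocal (c : Fin 3) {π : MvPolynomial (Fin 3) ℂ} (hπ : Prime π)
    {k : ℤ} (hk : HasOrd (primeLocal (veroneseChart c) (veroneseChart_injective c) hπ)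
      (veroneseChart c π) (logFormCoeff c) k) :
    HasFormOrder (primeLocal (veroneseChart c) (veroneseChart_injective c) hπ) logForm k := by
  rw [HasFormOrder, regularForms_primeLocal, logForm_eq c]
  exact hasOrderAlong_smul (irreducible_primeLocalUniformizer (veroneseChart_injective c) hπ) hk

theorem isDiscreteValuationRing_localRingAt {P : Ideal VeroneseRing} [P.IsPrime]
    (hP : P.height = 1) : IsDiscreteValuationRing (localRingAt VeroneseRing P) := by
  obtain ⟨c, hc⟩ := exists_veronesePow_not_mem hP
  obtain ⟨π, hπ, _, hV⟩ := (isChart_veroneseChart c).exists_prime_of_height_eq_one hP hc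
  rw [hV]
  exact isDiscreteValuationRing_primeLocal _ hπ

theorem exists_order_logForm {P : Ideal VeroneseRing} [P.IsPrime] (hP : P.height = 1) :
    ∃ k : ℤ, HasFormOrder (localRingAt VeroneseRing P) logForm k ∧
      HasFunctionOrder (localRingAt VeroneseRing P) logFormFun ((4 : ℕ) * k) := by
  obtain ⟨c, hc⟩ := exists_veronesePow_not_mem hP
  obtain ⟨π, hπ, hd, hV⟩ := (isChart_veroneseChart c).exists_prime_of_height_eq_one hP hc
  rw [hV]
  have hψ := veroneseChart_injective c
  have := isDiscreteValuationRing_primeLocal hψ hπ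
  have := isFractionRing_primeLocal hψ hπ (isChart_veroneseChart c).exists_div
  have hirr := irreducible_primeLocalUniformizer hψ hπ
  have hπ0 : veroneseChart c π ≠ 0 := (map_ne_zero_iff _ hψ).2 hπ.ne_zero
  obtain ⟨k, hk⟩ := exists_hasOrd hirr (logFormCoeff_ne_zero c)
  refine ⟨k, hasFormOrder_logForm_primeLocal c hπ hk, ?_⟩
  rw [hasFunctionOrder_iff hirr, logFormFun_eq c]
  rw [hom_veronesePow] at hd
  have h1 := ((hk.pow 4).mul hπ0 ((hasOrd_sixteen _ _).pow 4).inv).mul hπ0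
    (.of_unit (exists_unit_primeLocal hψ hπ hd))
  rwa [mul_zero, neg_zero, add_zero, add_zero] at h1

/-- Every divisor over the origin has log discrepancy at least `3 / 4`. -/
theorem three_quarters_le_logDiscrepancy {V : Subalgebra ℂ VeroneseField} {a : ℝ}
    (hV : IsDivisorOver VeroneseRing V) (hc : HasCenter V (originIdeal (n := 3) 4 fun _ => 1))
    (ha : HasLogDiscrepancy VeroneseRing 3 V a) : 3 / 4 ≤ a := by
  refine three_quarters_le_of_hasLogDiscrepancy powFun_ne_zero (η := logForm) rfl logForm_ne_zero
    (fun P _ hP => isDiscreteValuationRing_localRingAt hP)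
    (fun P _ hP => exists_order_logForm hP) exists_eq_algebraMap_of_mem_localRingAt hV
    (fun c => hV.algebraMap_mem _) (fun c => (hc (veronesePow c)).1 ?_) ha
  rw [originIdeal, RingHom.mem_ker]
  change constantCoeff (X c ^ 4 : MvPolynomial (Fin 3) ℂ) = 0
  simp

/-- An invariant monomial of degree 4d with d > 0 acquires the factor X 0 ^ d on the chart. This
places the center of the exceptional divisor at the origin. -/
theorem X_zero_dvd_hom_sub (f : VeroneseRing) :
    X 0 ∣ (isChart_veroneseChart 0).hom f - C (constantCoeff f.1) := by
  refine veroneseRing_induction (motive := fun f => X 0 ∣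
    (isChart_veroneseChart 0).hom f - C (constantCoeff f.1)) ?_ ?_ f
  · intro p q hp hq
    convert dvd_add hp hq using 1
    push_cast
    simp only [map_add]
    ring
  · rintro α ⟨d, hd⟩ k
    have hhom : (isChart_veroneseChart 0).hom ⟨monomial α k, monomial_mem_veroneseRing ⟨d, hd⟩ k⟩ =
        C k * ∏ i, X i ^ (if i = 0 then d else α i) := by
      apply veroneseChart_injective 0
      rw [IsChart.map_hom, veroneseChart_monomial 0 hd]
    rw [hhom]
    rcases Nat.eq_zero_or_pos d with rfl | hd0
    · have hα : α = 0 := by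
        ext i
        rw [mul_zero, Finset.sum_eq_zero_iff] at hd
        exact hd i (Finset.mem_univ i)
      subst hα
      simp
    · have hα : α ≠ 0 := by
        rintro rfl
        simp at hd
        omega
      have : constantCoeff (monomial α k : MvPolynomial (Fin 3) ℂ) = 0 := by
        rw [constantCoeff_monomial, if_neg hα]
      rw [this, map_zero, sub_zero, Fin.prod_univ_three, if_pos rfl]
      exact Dvd.dvd.mul_left (Dvd.dvd.mul_right (Dvd.dvd.mul_right
        (dvd_pow_self _ hd0.ne') _) _) _

/-- The exceptional divisor of the blowup of the origin has log discrepancy `3 / 4`. -/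
theorem cyclicMld_le_three_quarters :
    cyclicMld (n := 3) 4 (fun _ => 1) ≤ ((3 / 4 : ℝ) : EReal) := by
  have hX : Prime (X 0 : MvPolynomial (Fin 3) ℂ) := X_prime
  have hψ := veroneseChart_injective 0
  have hch := isChart_veroneseChart 0
  have hX0 := veroneseChart_X_ne_zero 0 0
  have hdvr := isDiscreteValuationRing_primeLocal hψ hX
  have hirr := irreducible_primeLocalUniformizer hψ hX
  have hnd : ∀ i : Fin 3, i ≠ 0 → ¬ (X 0 : MvPolynomial (Fin 3) ℂ) ∣ X i := by
    intro i hi hd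
    rw [X_dvd_X] at hd
    simp [hi.symm] at hd
  refine sInf_le ⟨primeLocal (veroneseChart 0) hψ hX, 3 / 4, ⟨hdvr,
    isFractionRing_primeLocal hψ hX hch.exists_div, essFiniteType_primeLocal hψ hX, ?_⟩, ?_, ?_, rfl⟩
  · intro f
    rw [← hch.map_hom]
    exact map_mem_primeLocal hψ hX _
  · intro f
    have hunit : (∃ u : (primeLocal (veroneseChart 0) hψ hX)ˣ,
        ((u : primeLocal (veroneseChart 0) hψ hX) : VeroneseField) = algebraMap _ _ f) ↔
        ¬ X 0 ∣ hch.hom f := by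
      rw [← hch.map_hom]
      exact ⟨not_dvd_of_unit_primeLocal hψ hX, exists_unit_primeLocal hψ hX⟩
    rw [hunit, not_not, originIdeal, RingHom.mem_ker]
    change constantCoeff f.1 = 0 ↔ _
    have hd := X_zero_dvd_hom_sub f
    constructor
    · intro h0
      rwa [h0, map_zero, sub_zero] at hd
    · intro h1
      by_contra h0
      have := (dvd_sub_right h1).1 hd
      exact hX.not_isUnit (isUnit_of_dvd_unit this ((isUnit_iff_ne_zero.2 h0).map C))
  · have hk : HasOrd (primeLocal (veroneseChart 0) hψ hX) (veroneseChart 0 (X 0))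
        (logFormCoeff 0) (-1) := by
      exact (hasOrd_sixteen _ _).mul hX0 (((HasOrd.self.mul hX0 (.of_unit
        (exists_unit_primeLocal hψ hX (hnd 1 (by decide))))).mul hX0 (.of_unit
        (exists_unit_primeLocal hψ hX (hnd 2 (by decide))))).inv)
    -- The orders -1 and -3 give 1 + (-1 + 3/4) = 3/4.
    refine ⟨logForm, 4, logFormFun, logForm_ne_zero, by norm_num, ?_, ?_, -1, -3,
      hasFormOrder_logForm_primeLocal 0 hX hk, ?_, by norm_num⟩
    · exact inv_ne_zero (mul_ne_zero (mul_ne_zero (powFun_ne_zero 0) (powFun_ne_zero 1))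
        (powFun_ne_zero 2))
    · intro P _ hP
      exact exists_order_logForm hP
    · rw [hasFunctionOrder_iff hirr, logFormFun_eq 0]
      exact ((hk.pow 4).mul hX0 ((hasOrd_sixteen _ _).pow 4).inv).mul hX0 HasOrd.self

theorem three_quarters_le_cyclicMld :
    ((3 / 4 : ℝ) : EReal) ≤ cyclicMld (n := 3) 4 (fun _ => 1) := by
  refine le_sInf ?_
  rintro _ ⟨V, a, hV, hc, ha, rfl⟩
  exact EReal.coe_le_coe_iff.2 (three_quarters_le_logDiscrepancy hV hc ha)

end VeroneseMld

theorem IsMldGapThree.lt_one {δ : ℝ} (h : IsMldGapThree δ) : δ < 1 := by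
  have hlt : cyclicMld (n := 3) 4 (fun _ => 1) < 1 :=
    cyclicMld_le_three_quarters.trans_lt (by
      rw [← EReal.coe_one, EReal.coe_lt_coe_iff]; norm_num)
  have h1 := three_quarters_le_cyclicMld.trans
    (h.2 4 (fun _ => 1) (by norm_num) (fun _ => by simp) hlt)
  rw [EReal.coe_le_coe_iff] at h1
  linarith

end

/-! ### The main theorem -/

theorem mainTheorem8 (δ₃ : ℝ) (hδ₃ : 0 < δ₃) :
    (IsMldGapThree δ₃ → δ₃ < 1) ∧
    ∃ δ₀ : ℝ, 0 < δ₀ ∧ δ₀ ≤ δ₃ ∧ δ₀ < 1 ∧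
      ∀ (r : ℕ) (a : Fin 4 → ℤ) (e : ℤ) (k₀ : ℕ),
        0 < r →
        Int.gcd e r = Int.gcd (a 3) r →
        Int.gcd (a 0) r = 1 → Int.gcd (a 1) r = 1 → Int.gcd (a 2) r = 1 →
        1 ≤ k₀ → k₀ < r →
        ∑ i, residue r (a i * k₀) = residue r (e * k₀) + k₀ →
        (∀ k : ℕ, 1 ≤ k → k < r → k ≠ k₀ →
          ∑ i, residue r (a i * k) ≥ residue r (e * k) + r) →
        (k₀ : ℝ) / r ≤ 1 - δ₀ := by
  refine ⟨IsMldGapThree.lt_one, ?_⟩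
  obtain ⟨c, hc, h⟩ := exists_exceptional_bound
  -- The bound on k₀ / r comes from c; δ₃ and 1/2 enter only for δ₀ ≤ δ₃ and δ₀ < 1.
  refine ⟨min (min c δ₃) (1 / 2), by positivity,
    (min_le_left _ _).trans (min_le_right _ _), (min_le_right _ _).trans_lt (by norm_num), ?_⟩
  intro r a e k₀ hr _ _ _ _ hk1 hkr h0 hk
  have h1 : min (min c δ₃) (1 / 2) ≤ c := (min_le_left _ _).trans (min_le_left _ _)
  linarith [h r a e k₀ hr hk1 hkr h0 hk]
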